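/- **The game.** Two miners have probabilities $p_1,p_2\in(0,1)$, $p_1+p_2=1$, of winning a mining race, and costs $c_1,c_2\ge 0$ per unit of time. For $i\in\{1,2\}$ let $(C_i,s_i)$ be a capitulation policy for depth $d=\infty$, i.e. $C_i:\mathbb N\times\mathbb N\to\{0,1\}$ and $s_i\in\mathbb N$. If a turn starts at $(\ell_1,\ell_2)$ and player 1 wins the race, the new state is $(s_2,0)$ if $C_2(\ell_1,\ell_2)=1$ and $(\ell_1+1,\ell_2)$ otherwise; if player 2 wins, it is $(0,s_1)$ if $C_1(\ell_1,\ell_2)=1$ and $(\ell_1,\ell_2+1)$ otherwise. Let $\mathcal M$ be the set of states reachable from $(0,s_1)$ or $(s_2,0)$. For a probability $\mu$ on $\mathcal M$, under $\mathbb P_\mu$ the initial state $X_0$ has law $\mu$, the pairs (winner $\omega_n$, duration $\tau_n$) are i.i.d. and independent of $X_0$, winner and duration are independent, $\omega_n=i$ with probability $p_i$, and $\tau_n$ is exponential with a fixed positive parameter. Let $(X_n)_{n\ge0}$ be the resulting chain of states and $P$ its transition matrix. **Rewards.** If turn $n$ starts at $(\ell_1,\ell_2)$, let $r_{1,n}=\ell_1+1-s_2$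 if player 1 wins and $C_2(\ell_1,\ell_2)=1$, let $r_{2,n}=\ell_2+1-s_1$ if player 2 wins and $C_1(\ell_1,\ell_2)=1$, and let all other rewards be $0$; put $\mathrm{dist}_n=r_{1,n}+r_{2,n}$. Let $\hat r_1(\ell_1,\ell_2)=p_1(\ell_1+1-s_2)$ if $C_2(\ell_1,\ell_2)=1$ and $0$ otherwise, and $\hat r_2(\ell_1,\ell_2)=p_2(\ell_2+1-s_1)$ if $C_1(\ell_1,\ell_2)=1$ and $0$ otherwise. The policies are *feasible* if, for all $(\ell_1,\ell_2)\in\mathcal M$, $C_1(\ell_1,\ell_2)=1$ implies $s_1\le \ell_2+1$ and $C_2(\ell_1,\ell_2)=1$ implies $s_2\le\ell_1+1$ (so all rewards are nonnegative). **Proposition.** Suppose that both players have bounded gap tolerance: there is $\bar g\in\mathbb N$ such that, for all $(\ell_1,\ell_2)\in\mathbb N\times\mathbb N$, $\ell_2-\ell_1\ge\bar g$ implies $C_1(\ell_1,\ell_2)=1$, and $\ell_1-\ell_2\ge\bar g$ implies $C_2(\ell_1,\ell_2)=1$. Then: 1. The chain $(\mathcal M,P)$ is positive recurrent. With $L=\bar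 g+\max(\bar g,s_1)+1$ (so $L=2\bar g+1$ if $s_1\le\bar g$), the return time $T=\inf\{n\ge1: X_n=(s_2,0)\}$ of the chain started at $x=(s_2,0)$ satisfies $T\le L(N+1)$ $\mathbb P_x$-almost surely for a random variable $N$ with $\mathbb P_x(N=k)=(1-q)^kq$, $k\ge 0$, $q=p_1^{L}$. 2. The chain is irreducible and has a unique stationary distribution $\pi_P$. 3. If the policies are feasible, then the sums $\langle\pi_P,\hat r_i\rangle=\sum_{m\in\mathcal M}\pi_P(m)\hat r_i(m)$ converge, $\mathrm{dist}:=\langle\pi_P,\hat r_1+\hat r_2\rangle>0$, and: * for every initial distribution $\mu$ with $\mathbb E_\mu(\ell_1+\ell_2)<\infty$, $\displaystyle\lim_{n\to\infty}\frac1n\mathbb E_\mu\Big(1+\sum_{k=1}^n\mathrm{dist}_k\Big)=\mathrm{dist}$; * for every initial distribution $\mu$ and each $i$, $\displaystyle G_i:=\lim_{n\to\infty}\mathbb E_\mu\Big(\frac{\sum_{k=0}^{n-1}r_{i,k}}{1+\sum_{k=0}^{n-1}\mathrm{dist}_k}\Big)=\frac{\langle\pi_P,\hat r_i\rangle}{\mathrm{dist}}$;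 * if $\displaystyle\lim_{n\to\infty}\mathbb E_\nu\Big(\frac{\sum_{k=0}^{n-1}\tau_k}{1+\sum_{k=0}^{n-1}\mathrm{dist}_k}\Big)=\overline\tau$ for some initial distribution $\nu$, then for every initial distribution $\mu$ with $\mathbb E_\mu(\ell_1+\ell_2)<\infty$ and each $i$, $\displaystyle R_i:=\lim_{n\to\infty}\frac1n\mathbb E_\mu\Big(\sum_{k=0}^{n-1}(r_{i,k}-c_i\tau_k)\Big)=\mathrm{dist}\,(G_i-c_i\overline\tau)=\langle\pi_P,\hat r_i\rangle-c_i\overline\tau\,\mathrm{dist}.$ All expectations appearing here are of integrable random variables. -/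

import Mathlib

open MeasureTheory ProbabilityTheory Filter Topology

noncomputable section

/-- A capitulation policy in the game of infinite depth. `C (ℓ₁, ℓ₂) = true` means that a player who
loses the race of a turn starting at `(ℓ₁, ℓ₂)` capitulates, and then restarts with `s` blocks of
the opponent left to surpass. -/
structure CapPolicy where
  C : ℕ × ℕ → Bool
  s : ℕ

/-- The data of a two-player mining game with immediate release and depth `d = ∞`. Players 1 and 2
have the indices `0` and `1` in `Fin 2`. The number `p₁` is the probability that player 1 wins a
race, race durations are exponential of parameter `rate`, and `cost i` is the cost per time unit. -/
structure MiningGame where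
  pol₁ : CapPolicy
  pol₂ : CapPolicy
  p₁ : unitInterval
  p₁_pos : 0 < p₁
  p₁_lt_one : p₁ < 1
  rate : ℝ
  rate_pos : 0 < rate
  cost : Fin 2 → ℝ
  cost_nonneg : ∀ i, 0 ≤ cost i

namespace MiningGame

/-- The probability that a given player wins a mining race: `p₁` and `p₂ = 1 - p₁`. -/
def winProb (G : MiningGame) : Fin 2 → ℝ := ![(G.p₁ : ℝ), 1 - (G.p₁ : ℝ)]

/-- The pair `(ℓ₁, ℓ₂)` of branch lengths after a turn that starts at `m` and whose race is won by
player `w`. -/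
def next (G : MiningGame) (m : ℕ × ℕ) (w : Fin 2) : ℕ × ℕ :=
  if w = 0 then
    (if G.pol₂.C m then (G.pol₂.s, 0) else (m.1 + 1, m.2))
  else
    (if G.pol₁.C m then (0, G.pol₁.s) else (m.1, m.2 + 1))

/-- Pairs reachable from `m₀` through finitely many (possibly zero) turns. -/
inductive ReachableFrom (G : MiningGame) (m₀ : ℕ × ℕ) : ℕ × ℕ → Prop
  | refl : ReachableFrom G m₀ m₀
  | turn {m : ℕ × ℕ} (w : Fin 2) (h : ReachableFrom G m₀ m) : ReachableFrom G m₀ (G.next m w)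

/-- The set `𝓜` of states: the pairs reachable from `(0, s₁)` or from `(s₂, 0)`. -/
def states (G : MiningGame) : Set (ℕ × ℕ) :=
  {m | G.ReachableFrom (0, G.pol₁.s) m ∨ G.ReachableFrom (G.pol₂.s, 0) m}

/-- The state space `𝓜` as a type. It is countable, and all its subsets are measurable. -/
abbrev State (G : MiningGame) : Type := ↥G.states

/-- The state `(s₂, 0)`. -/
def base (G : MiningGame) : G.State := ⟨(G.pol₂.s, 0), Or.inr .refl⟩

/-- The deterministic update of the state, given the winner of the race. -/
def step (G : MiningGame) (m : G.State) (w : Fin 2) : G.State :=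
  ⟨G.next m.1 w, m.2.imp (.turn w) (.turn w)⟩

/-- The transition matrix `P` of the chain. -/
def P (G : MiningGame) (m m' : G.State) : ℝ :=
  ∑ w : Fin 2, if G.step m w = m' then G.winProb w else 0

/-- The law of the winner of one race. -/
def winnerLaw (G : MiningGame) : Measure (Fin 2) :=
  ∑ w : Fin 2, ENNReal.ofReal (G.winProb w) • Measure.dirac w

/-- The law of (winner, duration) of one race. -/
def raceLaw (G : MiningGame) : Measure (Fin 2 × ℝ) :=
  G.winnerLaw.prod (expMeasure G.rate)

/-- Outcomes: an initial state together with the sequence of (winner, duration) of the races. -/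
abbrev Omega (G : MiningGame) : Type := G.State × (ℕ → Fin 2 × ℝ)

/-- The law `ℙ_μ` of the game with initial distribution `μ`: independent identically distributed
races, independent of the initial state. -/
def law (G : MiningGame) (μ : Measure G.State) : Measure G.Omega :=
  μ.prod (Measure.infinitePi fun _ : ℕ => G.raceLaw)

/-- The winner of the race of turn `n`. -/
def winner (G : MiningGame) (n : ℕ) (ω : G.Omega) : Fin 2 := (ω.2 n).1

/-- The duration `τ_n` of turn `n`. -/
def tau (G : MiningGame) (n : ℕ) (ω : G.Omega) : ℝ := (ω.2 n).2

/-- The chain `X_n`. -/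
def X (G : MiningGame) : ℕ → G.Omega → G.State
  | 0, ω => ω.1
  | n + 1, ω => G.step (X G n ω) (G.winner n ω)

/-- Number of blocks of player `i` that are validated in a turn that starts at `m` and whose race is
won by player `w`. -/
def reward (G : MiningGame) (i : Fin 2) (m : G.State) (w : Fin 2) : ℝ :=
  if i = 0 then
    (if w = 0 ∧ G.pol₂.C m.1 then (m.1.1 : ℝ) + 1 - G.pol₂.s else 0)
  else
    (if w = 1 ∧ G.pol₁.C m.1 then (m.1.2 : ℝ) + 1 - G.pol₁.s else 0)

/-- `r_{i,n}`, the number of blocks of player `i` validated at the end of turn `n`. -/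
def r (G : MiningGame) (i : Fin 2) (n : ℕ) (ω : G.Omega) : ℝ :=
  G.reward i (G.X n ω) (G.winner n ω)

/-- The total number of blocks validated at the end of turn `n`. -/
def dist (G : MiningGame) (n : ℕ) (ω : G.Omega) : ℝ := G.r 0 n ω + G.r 1 n ω

/-- The vectors `r̂₁` and `r̂₂`. They are supported on the states at which a loss makes the opponent
of player `i` capitulate. -/
def rhat (G : MiningGame) (i : Fin 2) (m : G.State) : ℝ :=
  if i = 0 then
    (if G.pol₂.C m.1 then G.winProb 0 * ((m.1.1 : ℝ) + 1 - G.pol₂.s) else 0)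
  else
    (if G.pol₁.C m.1 then G.winProb 1 * ((m.1.2 : ℝ) + 1 - G.pol₁.s) else 0)

/-- First passage time `inf {n ≥ 1 : X_n = m}`, with value `⊤` if there is no such `n`. -/
def passageTime (G : MiningGame) (m : G.State) (ω : G.Omega) : ℕ∞ :=
  ⨅ (n : ℕ) (_ : 1 ≤ n ∧ G.X n ω = m), (n : ℕ∞)

/-- Any state is visited with positive probability from any other one. -/
def IsIrreducible (G : MiningGame) : Prop :=
  ∀ m m' : G.State, ∃ n : ℕ, 0 < G.law (Measure.dirac m) {ω | G.X n ω = m'}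

/-- Every state has a finite expected return time. -/
def IsPositiveRecurrent (G : MiningGame) : Prop :=
  ∀ m : G.State, ∫⁻ ω, (G.passageTime m ω : ENNReal) ∂(G.law (Measure.dirac m)) < ⊤

/-- `π` is a probability vector with `π P = π`. -/
def IsStationary (G : MiningGame) (π : G.State → ℝ) : Prop :=
  (∀ m, 0 ≤ π m) ∧ HasSum π 1 ∧ ∀ m', HasSum (fun m => π m * G.P m m') (π m')

/-- The gap tolerance of both players is bounded by `g`: whoever is behind by at least `g` blocks
capitulates after losing the race. -/
def BoundedGap (G : MiningGame) (g : ℕ) : Prop :=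
  ∀ m : ℕ × ℕ, (m.1 + g ≤ m.2 → G.pol₁.C m = true) ∧ (m.2 + g ≤ m.1 → G.pol₂.C m = true)

/-- In each capitulation that can occur in the game, the block from which the capitulating player
restarts exists in the branch of the opponent (possibly its root), so that the number of validated
blocks is nonnegative. -/
def Feasible (G : MiningGame) : Prop :=
  ∀ m ∈ G.states, (G.pol₁.C m = true → G.pol₁.s ≤ m.2 + 1) ∧
    (G.pol₂.C m = true → G.pol₂.s ≤ m.1 + 1)

/-- The initial distribution `μ` has a finite expected number of blocks `ℓ₁ + ℓ₂`. -/
def FiniteMean (G : MiningGame) (μ : Measure G.State) : Prop :=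
  Integrable (fun m : G.State => (m.1.1 : ℝ) + (m.1.2 : ℝ)) μ

/-- All `Y n` are integrable and `𝔼_μ (Y n) → a`. -/
def ExpectationTendsto (G : MiningGame) (μ : Measure G.State) (Y : ℕ → G.Omega → ℝ) (a : ℝ) :
    Prop :=
  (∀ n, Integrable (Y n) (G.law μ)) ∧
    Tendsto (fun n => ∫ ω, Y n ω ∂(G.law μ)) atTop (𝓝 a)

/-- Average revenue per turn of player `i` over the first `n` turns. -/
def avgRevenue (G : MiningGame) (i : Fin 2) (n : ℕ) (ω : G.Omega) : ℝ :=
  (∑ k ∈ Finset.range n, (G.r i k ω - G.cost i * G.tau k ω)) / n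

/-- Ratio of validated blocks owned by player `i` over the first `n` turns. -/
def ratio (G : MiningGame) (i : Fin 2) (n : ℕ) (ω : G.Omega) : ℝ :=
  (∑ k ∈ Finset.range n, G.r i k ω) / (1 + ∑ k ∈ Finset.range n, G.dist k ω)

/-- `(1 + ∑_{k=1}^n dist_k) / n`. -/
def avgDist (G : MiningGame) (n : ℕ) (ω : G.Omega) : ℝ :=
  (1 + ∑ k ∈ Finset.Icc 1 n, G.dist k ω) / n

/-- Time per validated block over the first `n` turns. -/
def timePerBlock (G : MiningGame) (n : ℕ) (ω : G.Omega) : ℝ :=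
  (∑ k ∈ Finset.range n, G.tau k ω) / (1 + ∑ k ∈ Finset.range n, G.dist k ω)

/-- The pairing `⟨x, y⟩` of two vectors indexed by the states. -/
def pairing (G : MiningGame) (x y : G.State → ℝ) : ℝ := ∑' m, x m * y m

end MiningGame

end

/-! The bounded gap provides a uniform way home. In every state `ℓ₂ - ℓ₁` is at most `max g s₁`, and
each win of player 1 either makes player 2 capitulate, which leads to `(s₂, 0)`, or improves the gap
by one. Hence a run of `L = g + max g s₁ + 1` wins of player 1 passes through `(s₂, 0)` from any
state. Cut the races into blocks of length `L`: the index of the first block won entirely by player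
1 is geometric and dominates the return time (`exists_geometric_domination`).

The rest is carried by one analytic tool. The powers of `weightedOp κ` compute expectations of
products of weights along the path (`integral_prod_path`). If a weight at most `θ < 1` can be met
within boundedly many turns from every state, these powers decay geometrically, uniformly in the
state (`exists_geometric_bound`). Killing on entry into a state gives positive recurrence. The
weight `exp (-reward)` gives an exponentially small probability of validating few blocks.

States grow at most linearly in time, so geometric decay beats polynomial growth, and the potential
`pot` of the chain killed at `(s₂, 0)` is defined on functions of polynomial growth. The ratio
`mean` of potentials at `(s₂, 0)` is the cycle formula for the stationary distribution, and the
potential of a centred function solves the Poisson equation (`poisson_sub_transOp`). This equation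
gives uniqueness of the stationary distribution and turns reward sums into a martingale plus
boundary terms. The second moment of the martingale grows linearly, whence an `L¹` law of large
numbers with error of order `√n`, linear in the size of the initial state (`exists_L1_bound`). This
linear dependence is why the averages per turn ask for a finite mean of `ℓ₁ + ℓ₂`; the ratio lies in
`[0, 1]` and needs no moment.

Durations are independent of the chain, so the expected time per block is `rate⁻¹` times the
expectation of `n / (1 + ∑ dist)`. This converges to `(rate * D)⁻¹` for every initial distribution
(`Feasible.inv_dist`, `Feasible.eq_of_timePerBlock`), so `τbar` has no other possible value and the
revenue formula is algebra. -/

noncomputable section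

/-! ### Weighted transition operators and their geometric decay -/

section

namespace MiningGame

variable (G : MiningGame)

lemma winProb_pos (w : Fin 2) : 0 < G.winProb w := by
  have h0 : (0 : ℝ) < G.p₁ := G.p₁_pos
  have h1 : (G.p₁ : ℝ) < 1 := G.p₁_lt_one
  fin_cases w
  · exact h0
  · exact sub_pos.2 h1

lemma winProb_sum : ∑ w, G.winProb w = 1 := by simp [winProb]

lemma winProb_lt_one (w : Fin 2) : G.winProb w < 1 := by
  have h := G.winProb_sum
  have h0 := G.winProb_pos 0
  have h1 := G.winProb_pos 1
  rw [Fin.sum_univ_two] at h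
  fin_cases w <;> simp <;> linarith

/-- The transition operator weighted by `κ`. -/
def weightedOp (κ : G.State → Fin 2 → ℝ) : Module.End ℝ (G.State → ℝ) where
  toFun f x := ∑ w, G.winProb w * (κ x w * f (G.step x w))
  map_add' f g := by
    funext x
    simp only [Pi.add_apply, ← Finset.sum_add_distrib]
    exact Finset.sum_congr rfl fun w _ => by ring
  map_smul' a f := by
    funext x
    simp only [Pi.smul_apply, smul_eq_mul, RingHom.id_apply, Finset.mul_sum]
    exact Finset.sum_congr rfl fun w _ => by ring

variable {G} {κ : G.State → Fin 2 → ℝ} {θ : ℝ}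

lemma weightedOp_apply (f : G.State → ℝ) (x : G.State) :
    G.weightedOp κ f x = ∑ w, G.winProb w * (κ x w * f (G.step x w)) := rfl

lemma weightedOp_pow_succ (n : ℕ) (f : G.State → ℝ) (x : G.State) :
    (G.weightedOp κ ^ (n + 1)) f x =
      ∑ w, G.winProb w * (κ x w * (G.weightedOp κ ^ n) f (G.step x w)) := by
  rw [pow_succ', Module.End.mul_apply, weightedOp_apply]

lemma weightedOp_pow_mono (h0 : ∀ x w, 0 ≤ κ x w) {f h : G.State → ℝ} (hfh : f ≤ h) (n : ℕ) :
    (G.weightedOp κ ^ n) f ≤ (G.weightedOp κ ^ n) h := by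
  induction n with
  | zero => simpa using hfh
  | succ n ih =>
    intro x
    rw [weightedOp_pow_succ, weightedOp_pow_succ]
    gcongr with w _
    · exact (G.winProb_pos w).le
    · exact h0 x w
    · exact ih _

lemma weightedOp_pow_nonneg (h0 : ∀ x w, 0 ≤ κ x w) {f : G.State → ℝ} (hf : 0 ≤ f) (n : ℕ) :
    0 ≤ (G.weightedOp κ ^ n) f := by
  simpa using weightedOp_pow_mono h0 hf n

/-- Within `n` turns from `x` there is a turn of weight at most `θ`, for some winners. -/
def Leaks (κ : G.State → Fin 2 → ℝ) (θ : ℝ) : ℕ → G.State → Prop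
  | 0, _ => False
  | n + 1, x => ∃ w, κ x w ≤ θ ∨ Leaks κ θ n (G.step x w)

lemma Leaks.succ : ∀ {n : ℕ} {x : G.State}, Leaks κ θ n x → Leaks κ θ (n + 1) x
  | _ + 1, _, ⟨w, h⟩ => ⟨w, h.imp_right fun h => Leaks.succ h⟩

lemma Leaks.mono {n m : ℕ} (hnm : n ≤ m) {x : G.State} (h : Leaks κ θ n x) : Leaks κ θ m x := by
  induction hnm with
  | refl => exact h
  | step _ ih => exact ih.succ

lemma weightedOp_pow_one_le_one (h0 : ∀ x w, 0 ≤ κ x w) (h1 : ∀ x w, κ x w ≤ 1) (n : ℕ)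
    (x : G.State) : (G.weightedOp κ ^ n) 1 x ≤ 1 := by
  induction n generalizing x with
  | zero => simp
  | succ n ih =>
    rw [weightedOp_pow_succ, ← G.winProb_sum]
    refine Finset.sum_le_sum fun w _ => ?_
    have := mul_le_one₀ (h1 x w) (weightedOp_pow_nonneg h0 zero_le_one n _) (ih (G.step x w))
    exact mul_le_of_le_one_right (G.winProb_pos w).le this

variable (G) in
/-- The smaller one of the two winning probabilities. -/
def minProb : ℝ := min (G.winProb 0) (G.winProb 1)

lemma minProb_pos : 0 < G.minProb := lt_min (G.winProb_pos 0) (G.winProb_pos 1)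

lemma minProb_le (w : Fin 2) : G.minProb ≤ G.winProb w := by
  fin_cases w
  · exact min_le_left _ _
  · exact min_le_right _ _

lemma minProb_lt_one : G.minProb < 1 := (minProb_le 0).trans_lt (G.winProb_lt_one 0)

/-- A prescribed sequence of `n` winners has probability at least `minProb ^ n`, and along the
leaking one a fraction `1 - θ` of the mass is lost. -/
lemma Leaks.weightedOp_pow_one_le (h0 : ∀ x w, 0 ≤ κ x w) (h1 : ∀ x w, κ x w ≤ 1) (hθ : θ ≤ 1) :
    ∀ {n : ℕ} {x : G.State}, Leaks κ θ n x →
      (G.weightedOp κ ^ n) 1 x ≤ 1 - G.minProb ^ n * (1 - θ)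
  | n + 1, x, ⟨w, h⟩ => by
    have hm := minProb_pos (G := G)
    have hP : 0 ≤ G.minProb ^ n * (1 - θ) := mul_nonneg (by positivity) (by linarith)
    have hP1 : G.minProb ^ n ≤ 1 := pow_le_one₀ hm.le minProb_lt_one.le
    have hle : ∀ v, κ x v * (G.weightedOp κ ^ n) 1 (G.step x v) ≤ 1 := fun v =>
      mul_le_one₀ (h1 x v) (weightedOp_pow_nonneg h0 zero_le_one n _)
        (weightedOp_pow_one_le_one h0 h1 n _)
    have hw : κ x w * (G.weightedOp κ ^ n) 1 (G.step x w) ≤ 1 - G.minProb ^ n * (1 - θ) := by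
      have hnn := weightedOp_pow_nonneg h0 zero_le_one n (G.step x w)
      have hl1 := weightedOp_pow_one_le_one h0 h1 n (G.step x w)
      rcases h with h | h
      · calc κ x w * (G.weightedOp κ ^ n) 1 (G.step x w) ≤ κ x w * 1 := by
              gcongr; exact h0 x w
          _ ≤ θ := by linarith
          _ ≤ 1 - G.minProb ^ n * (1 - θ) := by nlinarith
      · calc κ x w * (G.weightedOp κ ^ n) 1 (G.step x w)
            ≤ 1 * (G.weightedOp κ ^ n) 1 (G.step x w) := by
              gcongr
              exact h1 x w
          _ ≤ _ := by rw [one_mul]; exact Leaks.weightedOp_pow_one_le h0 h1 hθ h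
    rw [weightedOp_pow_succ]
    -- Only the winner `w` of the leak is charged with a loss; the other winner keeps at most its
    -- full probability.
    have : ∀ v, G.winProb v * (κ x v * (G.weightedOp κ ^ n) 1 (G.step x v)) ≤
        G.winProb v - if v = w then G.minProb ^ (n + 1) * (1 - θ) else 0 := by
      intro v
      have hv := G.winProb_pos v
      have hmv := minProb_le (G := G) v
      split_ifs with hvw
      · subst hvw
        rw [pow_succ']
        nlinarith [mul_le_mul_of_nonneg_left hw hv.le, mul_le_mul_of_nonneg_right hmv hP]
      · nlinarith [mul_le_mul_of_nonneg_left (hle v) hv.le]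
    refine (Finset.sum_le_sum fun v _ => this v).trans ?_
    rw [Finset.sum_sub_distrib, G.winProb_sum]
    simp

lemma weightedOp_pow_le_mul (h0 : ∀ x w, 0 ≤ κ x w) {a : ℝ} {n : ℕ}
    (ha : ∀ x, (G.weightedOp κ ^ n) 1 x ≤ a) (m : ℕ) (x : G.State) :
    (G.weightedOp κ ^ (m + n)) 1 x ≤ a * (G.weightedOp κ ^ m) 1 x := by
  rw [pow_add, Module.End.mul_apply]
  have := weightedOp_pow_mono h0 (h := a • (1 : G.State → ℝ)) (fun y => by simpa using ha y) m x
  simpa using this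

/-- If leaking is possible within a uniformly bounded number of turns, the total weight decays
geometrically. -/
lemma exists_geometric_bound (h0 : ∀ x w, 0 ≤ κ x w) (h1 : ∀ x w, κ x w ≤ 1) (hθ0 : 0 ≤ θ)
    (hθ : θ < 1) {K : ℕ} (hK : ∀ x, Leaks κ θ K x) :
    ∃ C ρ : ℝ, 0 < C ∧ 0 < ρ ∧ ρ < 1 ∧ ∀ n x, (G.weightedOp κ ^ n) 1 x ≤ C * ρ ^ n := by
  -- `Leaks` is false for zero turns and there is at least one state, so `K = 0` is excluded.
  have hKpos : 0 < K := by
    rcases Nat.eq_zero_or_pos K with h | h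
    · subst h; exact (hK G.base).elim
    · exact h
  have hK1 : (1 : ℝ) ≤ K := by exact_mod_cast hKpos
  set δ : ℝ := G.minProb ^ K * (1 - θ) with hδ
  have hm := minProb_pos (G := G)
  have hδ0 : 0 < δ := mul_pos (by positivity) (by linarith)
  have hδ1 : δ < 1 := by
    have : G.minProb ^ K < 1 := pow_lt_one₀ hm.le minProb_lt_one hKpos.ne'
    have h2 : (1 - θ) ≤ 1 := by linarith
    calc δ ≤ G.minProb ^ K * 1 := by rw [hδ]; gcongr
      _ < 1 := by linarith
  have hd : δ / K ≤ δ := div_le_self hδ0.le hK1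
  have hd0 : 0 < δ / K := by positivity
  -- By Bernoulli's inequality `1 - δ ≤ ρ ^ K`, so no `K`-th root is needed. The constant `(ρ ^
  -- K)⁻¹` makes the bound trivial for `n < K`, which starts the induction in steps of `K`.
  set ρ : ℝ := 1 - δ / K with hρ
  have hρ0 : 0 < ρ := by linarith
  have hρ1 : ρ < 1 := by linarith
  have hρK : 1 - δ ≤ ρ ^ K := by
    have := one_add_mul_le_pow (a := -(δ / K)) (by linarith) K
    have e : (1 : ℝ) + K * -(δ / K) = 1 - δ := by field_simp; ring
    rw [e] at this
    simpa [hρ, sub_eq_add_neg] using this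
  refine ⟨(ρ ^ K)⁻¹, ρ, by positivity, hρ0, hρ1, fun n => ?_⟩
  induction n using Nat.strong_induction_on with
  | _ n ih =>
    intro x
    rcases lt_or_ge n K with hn | hn
    · refine (weightedOp_pow_one_le_one h0 h1 n x).trans ?_
      rw [inv_mul_eq_div, one_le_div (by positivity)]
      exact pow_le_pow_of_le_one hρ0.le hρ1.le hn.le
    · have hb := weightedOp_pow_le_mul h0 (ih (n - K) (by omega)) K x
      rw [Nat.add_sub_cancel' hn] at hb
      have hx := (hK x).weightedOp_pow_one_le h0 h1 hθ.le
      have hc : (0 : ℝ) ≤ (ρ ^ K)⁻¹ * ρ ^ (n - K) := by positivity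
      calc (G.weightedOp κ ^ n) 1 x ≤ (ρ ^ K)⁻¹ * ρ ^ (n - K) * ρ ^ K :=
            hb.trans (mul_le_mul_of_nonneg_left (hx.trans hρK) hc)
        _ = (ρ ^ K)⁻¹ * ρ ^ n := by rw [mul_assoc, ← pow_add, Nat.sub_add_cancel hn]

/-! ### Size of states and functions of polynomial growth -/

/-- One plus the number of blocks of a state. -/
def size (x : G.State) : ℝ := 1 + x.1.1 + x.1.2

lemma one_le_size (x : G.State) : 1 ≤ size x := by
  unfold size
  linarith [(x.1.1).cast_nonneg (α := ℝ), (x.1.2).cast_nonneg (α := ℝ)]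

lemma size_pos (x : G.State) : 0 < size x := zero_lt_one.trans_le (one_le_size x)

variable (G) in
/-- A bound for the increments of the size in one turn. -/
def jump : ℝ := 1 + G.pol₁.s + G.pol₂.s

lemma jump_pos : 0 < G.jump := by unfold jump; positivity

lemma size_step_le (x : G.State) (w : Fin 2) : size (G.step x w) ≤ size x + G.jump := by
  have a := (x.1.1).cast_nonneg (α := ℝ)
  have b := (x.1.2).cast_nonneg (α := ℝ)
  have c := (G.pol₁.s).cast_nonneg (α := ℝ)
  have d := (G.pol₂.s).cast_nonneg (α := ℝ)
  unfold size jump step next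
  dsimp only
  split_ifs <;> push_cast <;> linarith

/-- After `n` turns the size has increased by at most `n * jump`, so only the values of `f` on that
range of sizes matter, and a bound for them factors out of the remaining mass. -/
lemma abs_weightedOp_pow_le (h0 : ∀ x w, 0 ≤ κ x w) {f : G.State → ℝ} (n : ℕ) (x : G.State)
    {c : ℝ} (hc : ∀ y, size y ≤ size x + n * G.jump → |f y| ≤ c) :
    |(G.weightedOp κ ^ n) f x| ≤ c * (G.weightedOp κ ^ n) 1 x := by
  induction n generalizing x with
  | zero => simpa using hc x (by simp)
  | succ n ih =>
    rw [weightedOp_pow_succ, weightedOp_pow_succ, Finset.mul_sum]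
    refine (Finset.abs_sum_le_sum_abs _ _).trans (Finset.sum_le_sum fun w _ => ?_)
    have := ih (G.step x w) fun y hy => hc y (by
      have := size_step_le x w
      push_cast; linarith)
    rw [abs_mul, abs_mul, abs_of_pos (G.winProb_pos w), abs_of_nonneg (h0 x w)]
    calc G.winProb w * (κ x w * |(G.weightedOp κ ^ n) f (G.step x w)|)
        ≤ G.winProb w * (κ x w * (c * (G.weightedOp κ ^ n) 1 (G.step x w))) := by
          have := (G.winProb_pos w).le
          have := h0 x w
          gcongr
      _ = _ := by ring

/-- Polynomial growth of degree at most `p`. -/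
def HasGrowth (p : ℕ) (f : G.State → ℝ) : Prop := ∃ c, 0 ≤ c ∧ ∀ x, |f x| ≤ c * size x ^ p

lemma HasGrowth.of_le {p : ℕ} {f h : G.State → ℝ} (hf : HasGrowth p f) (hh : ∀ x, |h x| ≤ |f x|) :
    HasGrowth p h := by
  obtain ⟨c, hc, h⟩ := hf
  exact ⟨c, hc, fun x => (hh x).trans (h x)⟩

lemma HasGrowth.abs {p : ℕ} {f : G.State → ℝ} (hf : HasGrowth p f) :
    HasGrowth p (fun x => |f x|) := hf.of_le fun x => by simp

lemma HasGrowth.add {p : ℕ} {f h : G.State → ℝ} (hf : HasGrowth p f) (hh : HasGrowth p h) :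
    HasGrowth p (f + h) := by
  obtain ⟨c, hc, h1⟩ := hf
  obtain ⟨d, hd, h2⟩ := hh
  refine ⟨c + d, by positivity, fun x => ?_⟩
  rw [add_mul]
  exact (abs_add_le _ _).trans (add_le_add (h1 x) (h2 x))

lemma HasGrowth.smul {p : ℕ} {f : G.State → ℝ} (hf : HasGrowth p f) (a : ℝ) :
    HasGrowth p (a • f) := by
  obtain ⟨c, hc, h1⟩ := hf
  refine ⟨|a| * c, by positivity, fun x => ?_⟩
  rw [Pi.smul_apply, smul_eq_mul, abs_mul, mul_assoc]
  exact mul_le_mul_of_nonneg_left (h1 x) (abs_nonneg a)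

lemma HasGrowth.sub {p : ℕ} {f h : G.State → ℝ} (hf : HasGrowth p f) (hh : HasGrowth p h) :
    HasGrowth p (f - h) := by
  have := hf.add (hh.smul (-1))
  rwa [neg_one_smul, ← sub_eq_add_neg] at this

lemma HasGrowth.sq {p : ℕ} {f : G.State → ℝ} (hf : HasGrowth p f) :
    HasGrowth (2 * p) (fun x => f x ^ 2) := by
  obtain ⟨c, hc, h1⟩ := hf
  refine ⟨c ^ 2, by positivity, fun x => ?_⟩
  rw [abs_pow, mul_comm 2 p, pow_mul, ← mul_pow]
  exact pow_le_pow_left₀ (abs_nonneg _) (h1 x) 2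

lemma hasGrowth_const (p : ℕ) (a : ℝ) : HasGrowth (G := G) p (fun _ => a) :=
  ⟨|a|, abs_nonneg a, fun x =>
    le_mul_of_one_le_right (abs_nonneg a) (one_le_pow₀ (one_le_size x))⟩

lemma hasGrowth_one (p : ℕ) : HasGrowth (G := G) p 1 := hasGrowth_const p 1

lemma HasGrowth.comp_step {p : ℕ} {f : G.State → ℝ} (hf : HasGrowth p f) (w : Fin 2) :
    HasGrowth p (fun x => f (G.step x w)) := by
  obtain ⟨c, hc, h1⟩ := hf
  refine ⟨c * (1 + G.jump) ^ p, by have := jump_pos (G := G); positivity, fun x => (h1 _).trans ?_⟩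
  rw [mul_assoc, ← mul_pow]
  have := size_step_le x w
  have h2 := one_le_size x
  have h3 := jump_pos (G := G)
  have h4 := (size_pos (G.step x w)).le
  gcongr
  nlinarith

lemma HasGrowth.weightedOp {p : ℕ} {f : G.State → ℝ} (hf : HasGrowth p f)
    (h0 : ∀ x w, 0 ≤ κ x w) (h1 : ∀ x w, κ x w ≤ 1) : HasGrowth p (G.weightedOp κ f) := by
  have hT : ∀ w, HasGrowth p (fun x => κ x w * f (G.step x w)) := fun w =>
    (hf.comp_step w).of_le fun x => by
      rw [abs_mul, abs_of_nonneg (h0 x w)]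
      exact mul_le_of_le_one_left (abs_nonneg _) (h1 x w)
  have := ((hT 0).smul (G.winProb 0)).add ((hT 1).smul (G.winProb 1))
  refine this.of_le fun x => ?_
  rw [weightedOp_apply, Fin.sum_univ_two]
  rfl

/-- Uniform decay of the iterates on functions of polynomial growth. -/
lemma exists_growth_decay (h0 : ∀ x w, 0 ≤ κ x w) (h1 : ∀ x w, κ x w ≤ 1) (hθ0 : 0 ≤ θ)
    (hθ : θ < 1) {K : ℕ} (hK : ∀ x, Leaks κ θ K x) (p : ℕ) :
    ∃ b : ℕ → ℝ, Summable b ∧ (∀ n, 0 ≤ b n) ∧ ∀ (f : G.State → ℝ) (c : ℝ),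
      (∀ x, |f x| ≤ c * size x ^ p) → ∀ n x,
        |(G.weightedOp κ ^ n) f x| ≤ c * size x ^ p * b n := by
  obtain ⟨C, ρ, hC, hρ0, hρ1, hb⟩ := exists_geometric_bound h0 h1 hθ0 hθ hK
  have hj := jump_pos (G := G)
  refine ⟨fun n => (1 + n * G.jump) ^ p * (C * ρ ^ n), ?_, fun n => by positivity,
    fun f c hf n x => ?_⟩
  -- Comparison with the series of `(n + 1) ^ p * ρ ^ (n + 1)`, through `1 + n * jump ≤ (1 + jump) *
  -- (n + 1)`.
  · have hs : Summable fun n : ℕ => ((n : ℝ) ^ p * ρ ^ n) :=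
      summable_pow_mul_geometric_of_norm_lt_one p (by rwa [Real.norm_of_nonneg hρ0.le])
    have hs' := (((summable_nat_add_iff 1).2 hs).mul_left (((1 + G.jump) ^ p) * C * ρ⁻¹))
    refine Summable.of_nonneg_of_le (fun n => by positivity) (fun n => ?_) hs'
    have e : (1 + G.jump) ^ p * C * ρ⁻¹ * (((n + 1 : ℕ) : ℝ) ^ p * ρ ^ (n + 1)) =
        ((1 + G.jump) * ((n + 1 : ℕ) : ℝ)) ^ p * (C * ρ ^ n) := by
      rw [mul_pow, pow_succ]; field_simp
    rw [e]
    gcongr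
    push_cast
    nlinarith [(n.cast_nonneg : (0 : ℝ) ≤ n)]
  · have hx := one_le_size x
    have hc : 0 ≤ c := by
      have h2 := (abs_nonneg _).trans (hf x)
      exact nonneg_of_mul_nonneg_left h2 (pow_pos (size_pos x) p)
    have := abs_weightedOp_pow_le h0 n x (f := f) (c := c * (size x * (1 + n * G.jump)) ^ p)
      fun y hy => (hf y).trans (by
        have := (size_pos y).le
        have hn : 0 ≤ n * G.jump := by positivity
        gcongr
        nlinarith)
    refine this.trans ?_
    rw [mul_pow, mul_assoc, mul_assoc, mul_assoc]
    have hs := size_pos x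
    gcongr
    exact mul_le_mul_of_nonneg_left (hb n x) (by positivity)

end MiningGame

end

/-! ### Potential of the killed chain, stationary distribution and Poisson equation -/

section

namespace MiningGame

/-- The weight that kills the chain when it enters `m`. -/
def avoid (G : MiningGame) (m x : G.State) (w : Fin 2) : ℝ := if G.step x w = m then 0 else 1

/-- The transition operator of the chain. -/
def transOp (G : MiningGame) : Module.End ℝ (G.State → ℝ) := G.weightedOp fun _ _ => 1

/-- The transition operator of the chain killed when it enters the state `(s₂, 0)`. -/
def killedOp (G : MiningGame) : Module.End ℝ (G.State → ℝ) := G.weightedOp (G.avoid G.base)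

/-- The expected sum of `f` along the chain until it enters `(s₂, 0)`. -/
def pot (G : MiningGame) (f : G.State → ℝ) (x : G.State) : ℝ := ∑' n, (G.killedOp ^ n) f x

/-- The state `(s₂, 0)` can be entered within `K` turns from any state. -/
def HitsBase (G : MiningGame) (K : ℕ) : Prop := ∀ x, Leaks (G.avoid G.base) 0 K x

variable {G : MiningGame} {f h : G.State → ℝ} {p K : ℕ}

lemma avoid_nonneg (m x : G.State) (w : Fin 2) : 0 ≤ G.avoid m x w := by
  unfold avoid; split_ifs <;> norm_num

lemma avoid_le_one (m x : G.State) (w : Fin 2) : G.avoid m x w ≤ 1 := by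
  unfold avoid; split_ifs <;> norm_num

lemma transOp_apply (f : G.State → ℝ) (x : G.State) :
    G.transOp f x = ∑ w, G.winProb w * f (G.step x w) := by
  simp [transOp, weightedOp_apply]

/-- The mass `1 - killedOp 1` lost by killing is exactly the mass that enters `(s₂, 0)`, where `f`
takes the value `f base`. -/
lemma transOp_eq (f : G.State → ℝ) :
    G.transOp f = G.killedOp f + f G.base • (1 - G.killedOp 1) := by
  funext x
  simp only [transOp_apply, killedOp, Pi.add_apply, Pi.smul_apply, Pi.sub_apply, Pi.one_apply,
    weightedOp_apply, smul_eq_mul, mul_one]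
  rw [← G.winProb_sum]
  rw [← Finset.sum_sub_distrib, Finset.mul_sum, ← Finset.sum_add_distrib]
  refine Finset.sum_congr rfl fun w _ => ?_
  unfold avoid
  split_ifs with hw
  · rw [hw]; ring
  · ring

lemma killedOp_nonneg (hf : 0 ≤ f) : 0 ≤ G.killedOp f := by
  simpa [killedOp] using weightedOp_pow_nonneg (avoid_nonneg G.base) hf 1

lemma HasGrowth.killedOp (hf : HasGrowth p f) : HasGrowth p (G.killedOp f) :=
  hf.weightedOp (avoid_nonneg _) (avoid_le_one _)

lemma HasGrowth.transOp (hf : HasGrowth p f) : HasGrowth p (G.transOp f) :=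
  hf.weightedOp (by simp) (by simp)

lemma HitsBase.exists_pot_bound (hK : G.HitsBase K) (p : ℕ) :
    ∃ C : ℝ, 0 ≤ C ∧ ∀ (f : G.State → ℝ) (c : ℝ), (∀ x, |f x| ≤ c * size x ^ p) → ∀ x,
      Summable (fun n => (G.killedOp ^ n) f x) ∧ |G.pot f x| ≤ C * c * size x ^ p := by
  obtain ⟨b, hb, hb0, hd⟩ := exists_growth_decay (avoid_nonneg G.base) (avoid_le_one G.base)
    le_rfl zero_lt_one hK p
  refine ⟨∑' n, b n, tsum_nonneg hb0, fun f c hf x => ?_⟩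
  have hs := hb.mul_left (c * size x ^ p)
  have hd' : ∀ n, ‖(G.killedOp ^ n) f x‖ ≤ c * size x ^ p * b n := fun n => hd f c hf n x
  refine ⟨Summable.of_norm_bounded hs hd', ?_⟩
  have := tsum_of_norm_bounded hs.hasSum hd'
  rw [tsum_mul_left] at this
  refine (this : |_| ≤ _).trans_eq (by ring)

lemma HitsBase.summable (hK : G.HitsBase K) (hf : HasGrowth p f) (x : G.State) :
    Summable fun n => (G.killedOp ^ n) f x := by
  obtain ⟨C, -, h⟩ := hK.exists_pot_bound p
  obtain ⟨c, -, hc⟩ := hf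
  exact (h f c hc x).1

lemma HasGrowth.pot (hf : HasGrowth p f) (hK : G.HitsBase K) : HasGrowth p (G.pot f) := by
  obtain ⟨C, hC, h⟩ := hK.exists_pot_bound p
  obtain ⟨c, hc0, hc⟩ := hf
  exact ⟨C * c, by positivity, fun x => (h f c hc x).2⟩

lemma pot_nonneg (hf : 0 ≤ f) : 0 ≤ G.pot f := fun x =>
  tsum_nonneg fun n => weightedOp_pow_nonneg (avoid_nonneg G.base) hf n x

lemma pot_add (hK : G.HitsBase K) (hf : HasGrowth p f) (hh : HasGrowth p h) :
    G.pot (f + h) = G.pot f + G.pot h := by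
  funext x
  simp only [pot, map_add, Pi.add_apply]
  exact (hK.summable hf x).tsum_add (hK.summable hh x)

lemma pot_smul (a : ℝ) : G.pot (a • f) = a • G.pot f := by
  funext x
  simp only [pot, map_smul, Pi.smul_apply, smul_eq_mul, tsum_mul_left]

lemma pot_sub (hK : G.HitsBase K) (hf : HasGrowth p f) (hh : HasGrowth p h) :
    G.pot (f - h) = G.pot f - G.pot h := by
  funext x
  simp only [pot, map_sub, Pi.sub_apply]
  exact (hK.summable hf x).tsum_sub (hK.summable hh x)

lemma pot_killedOp (hK : G.HitsBase K) (hf : HasGrowth p f) :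
    G.pot (G.killedOp f) = G.pot f - f := by
  funext x
  simp only [pot, Pi.sub_apply]
  rw [(hK.summable hf x).tsum_eq_zero_add]
  simp [pow_succ]

/-- Unlike in `pot_killedOp`, the operator acts from outside, so it has to be exchanged with the
series; this is possible because a turn has only two outcomes. -/
lemma killedOp_pot (hK : G.HitsBase K) (hf : HasGrowth p f) :
    G.killedOp (G.pot f) = G.pot f - f := by
  funext x
  simp only [pot, Pi.sub_apply]
  rw [(hK.summable hf x).tsum_eq_zero_add]
  simp only [pow_zero, Module.End.one_apply, add_sub_cancel_left]
  have : ∀ n, (G.killedOp ^ (n + 1)) f x = ∑ w, G.winProb w * (G.avoid G.base x w *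
      (G.killedOp ^ n) f (G.step x w)) := fun n => weightedOp_pow_succ n f x
  simp only [this]
  rw [Summable.tsum_finsetSum fun w _ =>
    ((hK.summable hf (G.step x w)).mul_left _).mul_left _]
  simp only [tsum_mul_left]
  rfl

/-- The potential of `1 - killedOp 1` is the constant one: the chain enters `(s₂, 0)` almost surely.
At `x = base` the two correction terms cancel, which is the invariance of the cycle formula. -/
lemma pot_transOp (hK : G.HitsBase K) (hf : HasGrowth p f) (x : G.State) :
    G.pot (G.transOp f) x = G.pot f x - f x + f G.base := by
  have h1 := hasGrowth_one (G := G) p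
  rw [transOp_eq, pot_add hK hf.killedOp ((h1.sub h1.killedOp).smul _), pot_smul,
    pot_sub hK h1 h1.killedOp, pot_killedOp hK hf, pot_killedOp hK h1]
  simp

lemma transOp_pot (hK : G.HitsBase K) (hf : HasGrowth p f) :
    G.transOp (G.pot f) = G.pot f - f + G.pot f G.base • (1 - G.killedOp 1) := by
  rw [transOp_eq, killedOp_pot hK hf]

lemma transOp_pot_le (hK : G.HitsBase K) (hf : HasGrowth p f) (h0 : 0 ≤ f) (x : G.State) :
    G.transOp (G.pot f) x ≤ G.pot f x - f x + G.pot f G.base := by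
  rw [transOp_pot hK hf]
  have h1 : 0 ≤ G.killedOp 1 x := killedOp_nonneg (G := G) zero_le_one x
  have h2 : 0 ≤ G.pot f G.base := pot_nonneg h0 _
  simp only [Pi.add_apply, Pi.sub_apply, Pi.smul_apply, Pi.one_apply, smul_eq_mul]
  nlinarith

/-- A bound on the expectation of `f` at time `n` that is uniform in `n`. Either the chain has not
yet entered `(s₂, 0)`, or an excursion from there is in progress. The induction varies `f`: one step
replaces it by `killedOp f` at the cost of the constant `f base`, and `pot_killedOp` absorbs this
cost. -/
lemma transOp_pow_le (hK : G.HitsBase K) (hf : HasGrowth p f) (h0 : 0 ≤ f) (n : ℕ)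
    (x : G.State) : (G.transOp ^ n) f x ≤ G.pot f x + G.pot f G.base := by
  induction n generalizing f with
  | zero =>
    have h1 := killedOp_pot hK hf
    have h2 : 0 ≤ G.killedOp (G.pot f) x := killedOp_nonneg (pot_nonneg h0) x
    have h3 : 0 ≤ G.pot f G.base := pot_nonneg h0 _
    rw [h1, Pi.sub_apply] at h2
    simp only [pow_zero, Module.End.one_apply]
    linarith
  | succ n ih =>
    have h1 : G.transOp f ≤ G.killedOp f + f G.base • 1 := by
      rw [transOp_eq]
      have h1 : (0 : G.State → ℝ) ≤ G.killedOp 1 := killedOp_nonneg zero_le_one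
      have h2 := h0 G.base
      intro y
      have := h1 y
      simp only [Pi.add_apply, Pi.sub_apply, Pi.smul_apply, Pi.one_apply, smul_eq_mul,
        Pi.zero_apply] at *
      nlinarith
    have h2 := weightedOp_pow_mono (κ := fun _ _ => 1) (by simp) h1 n x
    have h3 := ih hf.killedOp (killedOp_nonneg h0)
    have h4 := weightedOp_pow_one_le_one (G := G) (κ := fun _ _ => 1) (by simp) (by simp) n x
    have h5 := h0 G.base
    have h6 := h0 x
    rw [pow_succ, Module.End.mul_apply]
    change _ ≤ (G.transOp ^ n) _ x at h2
    change (G.transOp ^ n) 1 x ≤ 1 at h4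
    change (G.transOp ^ n) _ x ≤ _ at h2
    rw [map_add, map_smul] at h2
    rw [pot_killedOp hK hf] at h3
    simp only [Pi.add_apply, Pi.sub_apply, Pi.smul_apply, smul_eq_mul, Pi.zero_apply] at *
    nlinarith

lemma one_le_pot_one (hK : G.HitsBase K) : 1 ≤ G.pot 1 G.base := by
  have h1 := killedOp_pot hK (hasGrowth_one (G := G) 0)
  have h2 : 0 ≤ G.killedOp (G.pot 1) G.base := killedOp_nonneg (pot_nonneg zero_le_one) _
  rw [h1] at h2
  simpa using h2

variable (G) in
/-- The mean of `f` with respect to the stationary distribution, as a ratio of expected sums over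
a cycle from `(s₂, 0)` to `(s₂, 0)`. -/
def mean (f : G.State → ℝ) : ℝ := G.pot f G.base / G.pot 1 G.base

variable (G) in
/-- The stationary distribution. -/
def stat (m : G.State) : ℝ := G.mean (Pi.single m 1)

lemma hasSum_killedOp_pow (n : ℕ) (f : G.State → ℝ) (x : G.State) :
    HasSum (fun m => (G.killedOp ^ n) (Pi.single m 1) x * f m) ((G.killedOp ^ n) f x) := by
  induction n generalizing x with
  | zero =>
    simp only [pow_zero, Module.End.one_apply]
    have := hasSum_single (f := fun m => (Pi.single m 1 : G.State → ℝ) x * f m) x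
      fun m hm => by simp [hm.symm]
    simpa using this
  | succ n ih =>
    have e := fun h : G.State → ℝ => weightedOp_pow_succ (κ := G.avoid G.base) n h x
    change ∀ h, (G.killedOp ^ (n + 1)) h x = _ at e
    simp only [e, Finset.sum_mul]
    refine hasSum_sum fun w _ => ?_
    simp only [mul_assoc]
    exact ((ih (G.step x w)).mul_left _).mul_left _

lemma hasGrowth_single (m : G.State) : HasGrowth (G := G) 0 (Pi.single m 1) :=
  (hasGrowth_one 0).of_le fun x => by by_cases h : x = m <;> simp [h]

lemma single_nonneg (m : G.State) : (0 : G.State → ℝ) ≤ Pi.single m 1 := fun x => by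
  by_cases h : x = m <;> simp [h]

lemma killedOp_pow_single_nonneg (n : ℕ) (m x : G.State) :
    0 ≤ (G.killedOp ^ n) (Pi.single m 1) x :=
  weightedOp_pow_nonneg (avoid_nonneg _) (single_nonneg m) n x

/-- Fubini for the sum over times and final states; absolute summability comes from the potential of
`|f|`. -/
lemma hasSum_pot (hK : G.HitsBase K) (hf : HasGrowth p f) (x : G.State) :
    HasSum (fun m => G.pot (Pi.single m 1) x * f m) (G.pot f x) := by
  have habs : Summable fun q : ℕ × G.State =>
      ‖(G.killedOp ^ q.1) (Pi.single q.2 1) x * f q.2‖ := by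
    have e : ∀ q : ℕ × G.State, ‖(G.killedOp ^ q.1) (Pi.single q.2 1) x * f q.2‖ =
        (G.killedOp ^ q.1) (Pi.single q.2 1) x * |f q.2| := fun q => by
      rw [norm_mul, Real.norm_eq_abs, Real.norm_eq_abs,
        abs_of_nonneg (killedOp_pow_single_nonneg _ _ _)]
    simp only [e]
    rw [summable_prod_of_nonneg fun q =>
      mul_nonneg (killedOp_pow_single_nonneg _ _ _) (abs_nonneg _)]
    refine ⟨fun n => (hasSum_killedOp_pow n (fun m => |f m|) x).summable, ?_⟩
    simp only [fun n => (hasSum_killedOp_pow n (fun m => |f m|) x).tsum_eq]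
    exact hK.summable hf.abs x
  have hs := habs.of_norm
  have h1 := hs.hasSum.prod_fiberwise fun n => hasSum_killedOp_pow n f x
  rw [← h1.tsum_eq] at h1
  have h2 : HasSum (fun q : G.State × ℕ => (G.killedOp ^ q.2) (Pi.single q.1 1) x * f q.1)
      (∑' q : ℕ × G.State, (G.killedOp ^ q.1) (Pi.single q.2 1) x * f q.2) :=
    (Equiv.prodComm G.State ℕ).hasSum_iff.2 hs.hasSum
  have h3 := h2.prod_fiberwise fun m =>
    ((hK.summable (hasGrowth_single m) x).hasSum.mul_right (f m))
  have h4 := hs.hasSum.prod_fiberwise fun n => hasSum_killedOp_pow n f x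
  rw [← h4.tsum_eq] at h3
  exact h3

lemma hasSum_stat (hK : G.HitsBase K) (hf : HasGrowth p f) :
    HasSum (fun m => G.stat m * f m) (G.mean f) := by
  have := (hasSum_pot hK hf G.base).div_const (G.pot 1 G.base)
  simpa only [stat, mean, div_mul_eq_mul_div] using this

lemma mean_one (hK : G.HitsBase K) : G.mean 1 = 1 :=
  div_self (zero_lt_one.trans_le (one_le_pot_one hK)).ne'

lemma mean_transOp (hK : G.HitsBase K) (hf : HasGrowth p f) :
    G.mean (G.transOp f) = G.mean f := by
  rw [mean, mean, pot_transOp hK hf, sub_add_cancel]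

lemma P_eq (x m : G.State) : G.P x m = G.transOp (Pi.single m 1) x := by
  rw [transOp_apply, P]
  refine Finset.sum_congr rfl fun w _ => ?_
  by_cases h : G.step x w = m <;> simp [h]

lemma stat_nonneg (m : G.State) : 0 ≤ G.stat m :=
  div_nonneg (pot_nonneg (single_nonneg m) _) (pot_nonneg zero_le_one _)

lemma isStationary_stat (hK : G.HitsBase K) : G.IsStationary G.stat := by
  refine ⟨stat_nonneg, ?_, fun m' => ?_⟩
  · simpa [mean_one hK] using hasSum_stat hK (hasGrowth_one (G := G) 0)
  · have := hasSum_stat hK (hasGrowth_single m').transOp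
    rw [mean_transOp hK (hasGrowth_single m')] at this
    simp only [P_eq]
    exact this

variable (G) in
/-- The solution of the Poisson equation for `f`. -/
def poisson (f : G.State → ℝ) : G.State → ℝ := G.pot (f - G.mean f • 1)

lemma HasGrowth.sub_mean (hf : HasGrowth p f) : HasGrowth p (f - G.mean f • 1) :=
  hf.sub ((hasGrowth_one p).smul _)

lemma HasGrowth.poisson (hf : HasGrowth p f) (hK : G.HitsBase K) : HasGrowth p (G.poisson f) :=
  hf.sub_mean.pot hK

/-- Centring makes the potential vanish at `(s₂, 0)`, so the return term in `transOp_pot`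
disappears. -/
lemma poisson_sub_transOp (hK : G.HitsBase K) (hf : HasGrowth p f) (x : G.State) :
    G.poisson f x - G.transOp (G.poisson f) x = f x - G.mean f := by
  have h1 : G.pot (f - G.mean f • 1) G.base = 0 := by
    rw [pot_sub hK hf ((hasGrowth_one p).smul _), pot_smul]
    have := (zero_lt_one.trans_le (one_le_pot_one hK)).ne'
    simp [mean, this]
  rw [poisson, transOp_pot hK hf.sub_mean, h1]
  simp

lemma hasSum_P (v : G.State → ℝ) (x : G.State) :
    HasSum (fun m => G.P x m * v m) (G.transOp v x) := by
  simp only [P_eq, transOp_apply, Finset.sum_mul]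
  refine hasSum_sum fun w _ => ?_
  have := hasSum_single (f := fun m => G.winProb w * (Pi.single m 1 : G.State → ℝ) (G.step x w)
    * v m) (G.step x w) fun m hm => by simp [hm.symm]
  simpa using this

lemma P_nonneg (x m : G.State) : 0 ≤ G.P x m := by
  rw [P_eq]
  simpa [transOp] using weightedOp_pow_nonneg (κ := fun _ _ => 1) (by simp) (single_nonneg m) 1 x

/-- Invariance is defined state by state; boundedness of `h` justifies the exchange of sums that
tests it against `h`. -/
lemma IsStationary.hasSum_transOp {π : G.State → ℝ} (hπ : G.IsStationary π) {c : ℝ}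
    (hc : ∀ x, |h x| ≤ c) :
    Summable (fun m => π m * h m) ∧
      HasSum (fun x => π x * G.transOp h x) (∑' m, π m * h m) := by
  obtain ⟨h0, h1, h2⟩ := hπ
  have hsum : Summable fun m => π m * h m :=
    Summable.of_norm_bounded (h1.summable.mul_right c) fun m => by
      rw [norm_mul, Real.norm_of_nonneg (h0 m)]
      exact mul_le_mul_of_nonneg_left (hc m) (h0 m)
  refine ⟨hsum, ?_⟩
  have hs : Summable fun q : G.State × G.State => π q.1 * (G.P q.1 q.2 * h q.2) := by
    refine Summable.of_norm ?_
    have e : ∀ q : G.State × G.State, ‖π q.1 * (G.P q.1 q.2 * h q.2)‖ =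
        π q.1 * (G.P q.1 q.2 * |h q.2|) := fun q => by
      rw [norm_mul, norm_mul, Real.norm_of_nonneg (h0 _), Real.norm_of_nonneg (P_nonneg _ _),
        Real.norm_eq_abs]
    simp only [e]
    rw [summable_prod_of_nonneg fun q =>
      mul_nonneg (h0 _) (mul_nonneg (P_nonneg _ _) (abs_nonneg _))]
    have e1 : ∀ x, HasSum (fun m => π x * (G.P x m * |h m|))
        (π x * G.transOp (fun m => |h m|) x) := fun x =>
      (hasSum_P (fun m => |h m|) x).mul_left (π x)
    refine ⟨fun x => (e1 x).summable, ?_⟩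
    simp only [fun x => (e1 x).tsum_eq]
    refine Summable.of_nonneg_of_le (fun x => mul_nonneg (h0 x) ?_) (fun x => ?_)
      (h1.summable.mul_right c)
    · exact (hasSum_P (fun m => |h m|) x).nonneg fun m => mul_nonneg (P_nonneg _ _) (abs_nonneg _)
    · refine mul_le_mul_of_nonneg_left ?_ (h0 x)
      rw [transOp_apply]
      calc ∑ w, G.winProb w * |h (G.step x w)| ≤ ∑ w, G.winProb w * c :=
            Finset.sum_le_sum fun w _ => mul_le_mul_of_nonneg_left (hc _) (G.winProb_pos w).le
        _ = c := by rw [← Finset.sum_mul, G.winProb_sum, one_mul]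
  have h3 := hs.hasSum.prod_fiberwise fun x => (hasSum_P h x).mul_left (π x)
  have h4 : HasSum (fun q : G.State × G.State => π q.2 * (G.P q.2 q.1 * h q.1))
      (∑' q : G.State × G.State, π q.1 * (G.P q.1 q.2 * h q.2)) :=
    (Equiv.prodComm G.State G.State).hasSum_iff.2 hs.hasSum
  have h5 := h4.prod_fiberwise (g := fun m => π m * h m) fun m => by
    simpa only [mul_assoc] using (h2 m).mul_right (h m)
  rw [h5.tsum_eq]
  exact h3

/-- Integrate the Poisson equation for the indicator of `m` against `π`. Its solution has growth of
degree zero, hence is bounded, so the left side integrates to zero and the right side to `π m - stat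
m`. -/
lemma IsStationary.eq_stat (hK : G.HitsBase K) {π : G.State → ℝ} (hπ : G.IsStationary π) :
    π = G.stat := by
  funext m
  have hg := hasGrowth_single m
  obtain ⟨c, -, hc⟩ := hg.poisson hK
  obtain ⟨hs, hT⟩ := hπ.hasSum_transOp (h := G.poisson (Pi.single m 1)) (c := c)
    (by simpa using hc)
  have h1 := hs.hasSum.sub hT
  have h2 : HasSum (fun x => π x * (Pi.single m 1 : G.State → ℝ) x - π x * G.stat m)
      (π m - 1 * G.stat m) := by
    refine HasSum.sub ?_ (hπ.2.1.mul_right _)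
    have := hasSum_single (f := fun x => π x * (Pi.single m 1 : G.State → ℝ) x) m
      fun x hx => by simp [hx]
    simpa using this
  simp only [← mul_sub] at h1 h2
  simp only [poisson_sub_transOp hK hg] at h1
  have := h1.unique h2
  rw [sub_self, one_mul] at this
  linarith

/-- The stationary mass of `(s₂, 0)` is positive because the cycle starts there; `n`-step invariance
carries positivity to any `m` reached from it. -/
lemma stat_pos (hK : G.HitsBase K) (n : ℕ) {m : G.State}
    (hm : 0 < (G.transOp ^ n) (Pi.single m 1) G.base) : 0 < G.stat m := by
  have hb : 0 < G.stat G.base := by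
    have h1 := killedOp_pot hK (hasGrowth_single G.base)
    have h2 : 0 ≤ G.killedOp (G.pot (Pi.single G.base 1)) G.base :=
      killedOp_nonneg (pot_nonneg (single_nonneg _)) _
    rw [h1] at h2
    refine div_pos ?_ (zero_lt_one.trans_le (one_le_pot_one hK))
    simp at h2
    linarith
  have hg : ∀ n : ℕ, HasGrowth 0 ((G.transOp ^ n) (Pi.single m 1)) ∧
      G.mean ((G.transOp ^ n) (Pi.single m 1)) = G.stat m := fun n => by
    induction n with
    | zero => exact ⟨hasGrowth_single m, rfl⟩
    | succ n ih =>
      rw [pow_succ', Module.End.mul_apply, mean_transOp hK ih.1]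
      exact ⟨ih.1.transOp, ih.2⟩
  have := hasSum_stat hK (hg n).1
  rw [(hg n).2] at this
  refine (mul_pos hb hm).trans_le (le_hasSum this G.base fun y _ => mul_nonneg (stat_nonneg y) ?_)
  exact weightedOp_pow_nonneg (κ := fun _ _ => 1) (by simp) (single_nonneg m) n y

end MiningGame

end

/-! ### Consequences of the bounded gap: paths to prescribed states and positive rewards -/

section

namespace MiningGame

variable {G : MiningGame} {κ : G.State → Fin 2 → ℝ} {θ : ℝ} {g : ℕ}

/-- The state after the turns from `x` with the winners in the list `l`. -/
def run (G : MiningGame) (x : G.State) (l : List (Fin 2)) : G.State := l.foldl G.step x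

lemma run_cons (x : G.State) (w : Fin 2) (l : List (Fin 2)) :
    G.run x (w :: l) = G.run (G.step x w) l := rfl

lemma run_append (x : G.State) (l l' : List (Fin 2)) :
    G.run x (l ++ l') = G.run (G.run x l) l' := List.foldl_append

lemma leaks_avoid_of_run {m : G.State} :
    ∀ {l : List (Fin 2)} {x : G.State}, l ≠ [] → G.run x l = m → Leaks (G.avoid m) 0 l.length x
  | [w], x, _, h => ⟨w, Or.inl (by simp [avoid, show G.step x w = m from h])⟩
  | w :: v :: l, x, _, h => ⟨w, Or.inr (leaks_avoid_of_run (l := v :: l) (by simp) h)⟩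

lemma Leaks.of_run {n : ℕ} : ∀ {l : List (Fin 2)} {x : G.State},
    Leaks κ θ n (G.run x l) → Leaks κ θ (l.length + n) x
  | [], x, h => by simpa [run] using h
  | w :: l, x, h => by
    rw [List.length_cons, Nat.add_right_comm]
    exact ⟨w, Or.inr (Leaks.of_run h)⟩

lemma transOp_pow_single_pos {m : G.State} : ∀ {l : List (Fin 2)} {x : G.State},
    G.run x l = m → 0 < (G.transOp ^ l.length) (Pi.single m 1) x
  | [], x, h => by simp [show x = m from h]
  | w :: l, x, h => by
    rw [List.length_cons, pow_succ', Module.End.mul_apply, transOp_apply]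
    refine Finset.sum_pos' (fun v _ => ?_) ⟨w, Finset.mem_univ w, ?_⟩
    · exact mul_nonneg (G.winProb_pos v).le
        (weightedOp_pow_nonneg (κ := fun _ _ => 1) (by simp) (single_nonneg m) _ _)
    · exact mul_pos (G.winProb_pos w) (transOp_pow_single_pos h)

/-- The difference `ℓ₂ - ℓ₁` increases by a block only if player 1 does not capitulate, hence from a
value below `g`; a capitulation of player 1 resets it to `s₁`. -/
lemma BoundedGap.gap_le (hg : G.BoundedGap g) {m₀ m : ℕ × ℕ} (h : G.ReachableFrom m₀ m)
    (h₀ : m₀.2 ≤ m₀.1 + max g G.pol₁.s) : m.2 ≤ m.1 + max g G.pol₁.s := by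
  induction h with
  | refl => exact h₀
  | @turn m w _ ih =>
    have := (hg m).1
    unfold next
    split_ifs with h1 h2 h3
    · simp
    · simp only; omega
    · simp
    · simp only
      by_contra hc
      exact h3 (this (by omega))

lemma BoundedGap.state_gap_le (hg : G.BoundedGap g) (x : G.State) :
    x.1.2 ≤ x.1.1 + max g G.pol₁.s := by
  rcases x.2 with h | h
  · exact hg.gap_le h (by simp)
  · exact hg.gap_le h (by simp)

/-- Here `k` bounds the wins still missing before player 2 must capitulate, and `j` counts those
preceding the capitulation. Since `ℓ₁` only grows meanwhile, `s₂ ≤ ℓ₁` persists, and the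
capitulating turn then validates at least one block. -/
lemma BoundedGap.run_zeros (hg : G.BoundedGap g) (k : ℕ) (x : G.State)
    (h : x.1.2 + g ≤ x.1.1 + k) :
    ∃ j, j ≤ k ∧ G.run x (List.replicate (j + 1) 0) = G.base ∧
      (G.pol₂.s ≤ x.1.1 → 1 ≤ G.reward 0 (G.run x (List.replicate j 0)) 0) := by
  induction k generalizing x with
  | zero =>
    have hC := (hg x.1).2 h
    refine ⟨0, le_rfl, Subtype.ext ?_, fun hs => ?_⟩
    · simp [run, step, next, hC, base]
    · have : (G.pol₂.s : ℝ) ≤ x.1.1 := by exact_mod_cast hs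
      simp [run, reward, hC]
      linarith
  | succ k ih =>
    by_cases hC : G.pol₂.C x.1
    · refine ⟨0, by omega, Subtype.ext ?_, fun hs => ?_⟩
      · simp [run, step, next, hC, base]
      · have : (G.pol₂.s : ℝ) ≤ x.1.1 := by exact_mod_cast hs
        simp [run, reward, hC]
        linarith
    · have hx : (G.step x 0).1 = (x.1.1 + 1, x.1.2) := by simp [step, next, hC]
      obtain ⟨j, hj, h1, h2⟩ := ih (G.step x 0) (by rw [hx]; simp only; omega)
      refine ⟨j + 1, by omega, h1, fun hs => ?_⟩
      rw [List.replicate_succ, run_cons]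
      exact h2 (by rw [hx]; simp only; omega)

lemma BoundedGap.exists_run_eq_base (hg : G.BoundedGap g) (x : G.State) :
    ∃ j, j ≤ g + max g G.pol₁.s ∧ G.run x (List.replicate (j + 1) 0) = G.base := by
  obtain ⟨j, h1, h2, -⟩ := hg.run_zeros (g + max g G.pol₁.s) x (by
    have := hg.state_gap_le x
    omega)
  exact ⟨j, h1, h2⟩

lemma BoundedGap.exists_run_ones (hg : G.BoundedGap g) (k : ℕ) (x : G.State)
    (h : x.1.1 + g ≤ x.1.2 + k) : ∃ l, (G.run x l).1 = (0, G.pol₁.s) := by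
  induction k generalizing x with
  | zero =>
    have hC := (hg x.1).1 h
    exact ⟨[1], by simp [run, step, next, hC]⟩
  | succ k ih =>
    by_cases hC : G.pol₁.C x.1
    · exact ⟨[1], by simp [run, step, next, hC]⟩
    · have hx : (G.step x 1).1 = (x.1.1, x.1.2 + 1) := by simp [step, next, hC]
      obtain ⟨l, hl⟩ := ih (G.step x 1) (by rw [hx]; simp only; omega)
      exact ⟨1 :: l, hl⟩

lemma ReachableFrom.exists_run {m₀ : G.State} {m : ℕ × ℕ} (h : G.ReachableFrom m₀.1 m) :
    ∃ l, (G.run m₀ l).1 = m := by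
  induction h with
  | refl => exact ⟨[], rfl⟩
  | turn w _ ih =>
    obtain ⟨l, hl⟩ := ih
    exact ⟨l ++ [w], by rw [run_append, ← hl]; rfl⟩

/-- States are reachable from one of two restart points; the other one, `(0, s₁)`, is itself reached
from `(s₂, 0)` by wins of player 2. -/
lemma BoundedGap.exists_run_from_base (hg : G.BoundedGap g) (m : G.State) :
    ∃ l, G.run G.base l = m := by
  rcases m.2 with h | h
  · obtain ⟨l, hl⟩ := hg.exists_run_ones (G.base.1.1 + g) G.base (by omega)
    rw [← hl] at h
    obtain ⟨l', hl'⟩ := h.exists_run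
    exact ⟨l ++ l', by rw [run_append]; exact Subtype.ext hl'⟩
  · obtain ⟨l, hl⟩ := ReachableFrom.exists_run (m₀ := G.base) h
    exact ⟨l, Subtype.ext hl⟩

/-- Pass through `(s₂, 0)`, which takes a bounded number of turns, and continue with a fixed list.
The list is nonempty so that `m` is entered at a positive time, as a return requires. -/
lemma BoundedGap.exists_run (hg : G.BoundedGap g) (m : G.State) :
    ∃ K, ∀ x, ∃ l, l ≠ [] ∧ l.length ≤ K ∧ G.run x l = m := by
  obtain ⟨l, hl⟩ := hg.exists_run_from_base m
  refine ⟨g + max g G.pol₁.s + 1 + l.length, fun x => ?_⟩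
  obtain ⟨j, hj, hx⟩ := hg.exists_run_eq_base x
  refine ⟨List.replicate (j + 1) 0 ++ l, by simp, by simp; omega, ?_⟩
  rw [run_append, hx, hl]

lemma BoundedGap.exists_leaks_avoid (hg : G.BoundedGap g) (m : G.State) :
    ∃ K, ∀ x, Leaks (G.avoid m) 0 K x := by
  obtain ⟨K, hK⟩ := hg.exists_run m
  refine ⟨K, fun x => ?_⟩
  obtain ⟨l, h0, h1, h2⟩ := hK x
  exact (leaks_avoid_of_run h0 h2).mono h1

lemma BoundedGap.exists_hitsBase (hg : G.BoundedGap g) : ∃ K, G.HitsBase K :=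
  hg.exists_leaks_avoid G.base

/-- At `(s₂, 0)` one has `s₂ ≤ ℓ₁` with equality, so the reward clause of `run_zeros` applies. -/
lemma BoundedGap.exists_rewarding (hg : G.BoundedGap g) :
    ∃ l, 1 ≤ G.reward 0 (G.run G.base l) 0 := by
  obtain ⟨j, -, -, h⟩ := hg.run_zeros (G.base.1.2 + g) G.base (by omega)
  exact ⟨_, h le_rfl⟩

/-- The number of blocks validated in a turn. -/
def totalReward (G : MiningGame) (x : G.State) (w : Fin 2) : ℝ :=
  G.reward 0 x w + G.reward 1 x w

lemma Feasible.reward_nonneg (hF : G.Feasible) (i : Fin 2) (x : G.State) (w : Fin 2) :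
    0 ≤ G.reward i x w := by
  obtain ⟨h1, h2⟩ := hF x.1 x.2
  unfold reward
  split_ifs with ha hb hc
  · have : (G.pol₂.s : ℝ) ≤ x.1.1 + 1 := by exact_mod_cast h2 hb.2
    linarith
  · exact le_rfl
  · have : (G.pol₁.s : ℝ) ≤ x.1.2 + 1 := by exact_mod_cast h1 hc.2
    linarith
  · exact le_rfl

lemma Feasible.totalReward_nonneg (hF : G.Feasible) (x : G.State) (w : Fin 2) :
    0 ≤ G.totalReward x w := add_nonneg (hF.reward_nonneg 0 x w) (hF.reward_nonneg 1 x w)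

/-- From every state a turn validating at least one block can be met within a bounded number of
turns. This feeds `exists_geometric_bound` with the Laplace transform of the number of validated
blocks. -/
lemma BoundedGap.exists_leaks_totalReward (hg : G.BoundedGap g) (hF : G.Feasible) :
    ∃ K, ∀ x, Leaks (fun x w => Real.exp (-G.totalReward x w)) (Real.exp (-1)) K x := by
  obtain ⟨l, hl⟩ := hg.exists_rewarding
  obtain ⟨K, hK⟩ := hg.exists_run (G.run G.base l)
  refine ⟨K + 1, fun x => ?_⟩
  obtain ⟨l', -, h1, h2⟩ := hK x
  have : Leaks (fun x w => Real.exp (-G.totalReward x w)) (Real.exp (-1)) 1 (G.run x l') := by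
    refine ⟨0, Or.inl ?_⟩
    rw [h2]
    have := hF.reward_nonneg 1 (G.run G.base l) 0
    exact Real.exp_le_exp.2 (by unfold totalReward; linarith)
  exact this.of_run.mono (by omega)

lemma rhat_eq (i : Fin 2) (x : G.State) : G.rhat i x = ∑ w, G.winProb w * G.reward i x w := by
  fin_cases i <;> by_cases h1 : G.pol₁.C x.1 <;> by_cases h2 : G.pol₂.C x.1 <;>
    simp [rhat, reward, h1, h2]

lemma abs_reward_le (i : Fin 2) (x : G.State) (w : Fin 2) :
    |G.reward i x w| ≤ (1 + G.jump) * size x := by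
  have a := (x.1.1).cast_nonneg (α := ℝ)
  have b := (x.1.2).cast_nonneg (α := ℝ)
  have c := (G.pol₁.s).cast_nonneg (α := ℝ)
  have d := (G.pol₂.s).cast_nonneg (α := ℝ)
  have e : size x + G.jump ≤ (1 + G.jump) * size x := by
    nlinarith [one_le_size x, jump_pos (G := G)]
  refine le_trans ?_ e
  unfold reward size jump
  split_ifs <;> rw [abs_le] <;> constructor <;> linarith

lemma hasGrowth_rhat (i : Fin 2) : HasGrowth (G := G) 1 (G.rhat i) := by
  refine ⟨1 + G.jump, by linarith [jump_pos (G := G)], fun x => ?_⟩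
  rw [rhat_eq, pow_one]
  refine (Finset.abs_sum_le_sum_abs _ _).trans ?_
  calc ∑ w, |G.winProb w * G.reward i x w| ≤ ∑ w, G.winProb w * ((1 + G.jump) * size x) := by
        refine Finset.sum_le_sum fun w _ => ?_
        rw [abs_mul, abs_of_pos (G.winProb_pos w)]
        exact mul_le_mul_of_nonneg_left (abs_reward_le i x w) (G.winProb_pos w).le
    _ = _ := by rw [← Finset.sum_mul, G.winProb_sum, one_mul]

lemma Feasible.rhat_nonneg (hF : G.Feasible) (i : Fin 2) : 0 ≤ G.rhat i := fun x => by
  rw [rhat_eq]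
  exact Finset.sum_nonneg fun w _ => mul_nonneg (G.winProb_pos w).le (hF.reward_nonneg i x w)

/-- A state in which a win of player 1 pays is reached from `(s₂, 0)`, so it has positive stationary
mass; feasibility keeps the other states from compensating. -/
lemma Feasible.mean_rhat_pos (hF : G.Feasible) (hg : G.BoundedGap g) :
    0 < G.mean (G.rhat 0) + G.mean (G.rhat 1) := by
  obtain ⟨K, hK⟩ := hg.exists_hitsBase
  obtain ⟨l, hl⟩ := hg.exists_rewarding
  set y := G.run G.base l
  have hy : 0 < G.stat y := stat_pos hK l.length (transOp_pow_single_pos rfl)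
  have hr : 0 < G.rhat 0 y := by
    rw [rhat_eq]
    refine Finset.sum_pos' (fun w _ => mul_nonneg (G.winProb_pos w).le (hF.reward_nonneg 0 y w))
      ⟨0, Finset.mem_univ _, mul_pos (G.winProb_pos 0) (by linarith)⟩
  have h0 := hasSum_stat hK (hasGrowth_rhat (G := G) 0)
  have h1 := hasSum_stat hK (hasGrowth_rhat (G := G) 1)
  refine add_pos_of_pos_of_nonneg ((mul_pos hy hr).trans_le
    (le_hasSum h0 y fun m _ => mul_nonneg (stat_nonneg m) (hF.rhat_nonneg 0 m)))
    (h1.nonneg fun m => mul_nonneg (stat_nonneg m) (hF.rhat_nonneg 1 m))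

end MiningGame

end

/-! ### Law of the races, first step analysis and path expectations -/

section

lemma ProbabilityTheory.integral_id_expMeasure {r : ℝ} (hr : 0 < r) :
    ∫ t, t ∂(expMeasure r) = r⁻¹ := by
  have hm : Measurable (gammaPDF 1 r) := (measurable_gammaPDFReal 1 r).ennreal_ofReal
  rw [expMeasure, gammaMeasure, integral_withDensity_eq_integral_toReal_smul hm
    (ae_of_all _ fun _ => ENNReal.ofReal_lt_top)]
  have e : ∀ t, (gammaPDF 1 r t).toReal • t =
      (Set.Ioi (0 : ℝ)).indicator (fun t => r * (t ^ ((2 : ℝ) - 1) * Real.exp (-(r * t)))) t := by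
    intro t
    rw [gammaPDF, ENNReal.toReal_ofReal (gammaPDFReal_nonneg zero_lt_one hr t), smul_eq_mul]
    rcases lt_trichotomy t 0 with h | h | h
    · simp [gammaPDFReal, h.not_ge, h.not_gt]
    · simp [h]
    · rw [Set.indicator_of_mem (Set.mem_Ioi.2 h)]
      simp only [gammaPDFReal, h.le, if_true]
      norm_num
      ring
  simp only [e]
  rw [integral_indicator measurableSet_Ioi, integral_const_mul,
    Real.integral_rpow_mul_exp_neg_mul_Ioi two_pos hr]
  have : Real.Gamma 2 = 1 := by
    simp
  rw [this, Real.rpow_two]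
  field_simp

lemma ProbabilityTheory.integrable_id_expMeasure {r : ℝ} (hr : 0 < r) :
    Integrable (fun t => t) (expMeasure r) :=
  Integrable.of_integral_ne_zero (by rw [integral_id_expMeasure hr]; positivity)

namespace MiningGame

/-- Sequences of (winner, duration). -/
abbrev Races : Type := ℕ → Fin 2 × ℝ

/-- The sequence of races that starts with `a` and continues with `ω`. -/
def consRace (a : Fin 2 × ℝ) (ω : Races) : Races
  | 0 => a
  | n + 1 => ω n

/-- The law of the sequence of the races. -/
def racesLaw (G : MiningGame) : Measure Races := Measure.infinitePi fun _ : ℕ => G.raceLaw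

variable {G : MiningGame}

instance : IsProbabilityMeasure (expMeasure G.rate) := isProbabilityMeasure_expMeasure G.rate_pos

instance : IsProbabilityMeasure G.winnerLaw := by
  constructor
  simp only [winnerLaw, Measure.finsetSum_apply, Measure.smul_apply, measure_univ, smul_eq_mul,
    mul_one]
  rw [← ENNReal.ofReal_sum_of_nonneg fun w _ => (G.winProb_pos w).le, G.winProb_sum,
    ENNReal.ofReal_one]

instance : IsProbabilityMeasure G.raceLaw := by unfold raceLaw; infer_instance

instance : IsProbabilityMeasure G.racesLaw := by unfold racesLaw; infer_instance

lemma raceLaw_eq : G.raceLaw =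
    ENNReal.ofReal (G.winProb 0) • (expMeasure G.rate).map (Prod.mk 0) +
      ENNReal.ofReal (G.winProb 1) • (expMeasure G.rate).map (Prod.mk 1) := by
  rw [raceLaw, winnerLaw, Fin.sum_univ_two, Measure.add_prod, Measure.prod_smul_left,
    Measure.prod_smul_left, Measure.dirac_prod, Measure.dirac_prod]

lemma lintegral_raceLaw (f : Fin 2 → ENNReal) :
    ∫⁻ a, f a.1 ∂G.raceLaw = ∑ w, ENNReal.ofReal (G.winProb w) * f w := by
  have hf : Measurable fun a : Fin 2 × ℝ => f a.1 := (Measurable.of_discrete).comp measurable_fst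
  rw [raceLaw_eq, lintegral_add_measure, lintegral_smul_measure, lintegral_smul_measure,
    lintegral_map hf measurable_prodMk_left, lintegral_map hf measurable_prodMk_left,
    Fin.sum_univ_two]
  simp

lemma integral_raceLaw {f : Fin 2 × ℝ → ℝ} (hm : Measurable f)
    (hf : ∀ w, Integrable (fun t => f (w, t)) (expMeasure G.rate)) :
    ∫ a, f a ∂G.raceLaw = ∑ w, G.winProb w * ∫ t, f (w, t) ∂(expMeasure G.rate) := by
  have hi : ∀ w, Integrable f ((expMeasure G.rate).map (Prod.mk w)) := fun w =>
    (integrable_map_measure hm.aestronglyMeasurable measurable_prodMk_left.aemeasurable).2 (hf w)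
  rw [raceLaw_eq, integral_add_measure ((hi 0).smul_measure ENNReal.ofReal_ne_top)
      ((hi 1).smul_measure ENNReal.ofReal_ne_top), integral_smul_measure, integral_smul_measure,
    integral_map measurable_prodMk_left.aemeasurable hm.aestronglyMeasurable,
    integral_map measurable_prodMk_left.aemeasurable hm.aestronglyMeasurable, Fin.sum_univ_two,
    ENNReal.toReal_ofReal (G.winProb_pos 0).le, ENNReal.toReal_ofReal (G.winProb_pos 1).le]
  rfl

lemma measurable_consRace : Measurable fun q : (Fin 2 × ℝ) × Races => consRace q.1 q.2 := by
  refine measurable_pi_lambda _ fun n => ?_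
  cases n with
  | zero => exact measurable_fst
  | succ n => exact (measurable_pi_apply n).comp measurable_snd

/-- This is the source of the Markov property: prepending an independent race does not change the
law of the sequence. It suffices to check cylinders. -/
lemma map_consRace :
    (G.raceLaw.prod G.racesLaw).map (fun q => consRace q.1 q.2) = G.racesLaw := by
  classical
  refine Measure.eq_infinitePi _ fun s t ht => ?_
  have ht' : MeasurableSet (Set.pi (s : Set ℕ) t) :=
    MeasurableSet.pi s.countable_toSet fun i _ => ht i
  rw [Measure.map_apply measurable_consRace ht']
  -- The coordinates constrained by the cylinder after the first race, moved down by one.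
  set s' : Finset ℕ := (s.erase 0).image Nat.pred with hs'
  have hmem : ∀ n, n ∈ s' ↔ n + 1 ∈ s := by
    intro n
    simp only [hs', Finset.mem_image, Finset.mem_erase]
    constructor
    · rintro ⟨k, ⟨h0, hk⟩, rfl⟩
      rwa [Nat.pred_eq_sub_one, Nat.sub_add_cancel (Nat.pos_of_ne_zero h0)]
    · exact fun h => ⟨n + 1, ⟨by simp, h⟩, rfl⟩
  have e : (fun q : (Fin 2 × ℝ) × Races => consRace q.1 q.2) ⁻¹' Set.pi (s : Set ℕ) t =
      (if 0 ∈ s then t 0 else Set.univ) ×ˢ Set.pi (s' : Set ℕ) (fun n => t (n + 1)) := by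
    ext ⟨a, ω⟩
    simp only [Set.mem_preimage, Set.mem_pi, Set.mem_prod, Finset.mem_coe, hmem]
    constructor
    · intro h
      refine ⟨?_, fun n hn => h (n + 1) hn⟩
      split_ifs with h0
      · exact h 0 h0
      · trivial
    · rintro ⟨h0, h1⟩ n hn
      cases n with
      | zero => rwa [if_pos hn] at h0
      | succ n => exact h1 n hn
  have hprod : ∏ i ∈ s, G.raceLaw (t i) = (G.raceLaw (if 0 ∈ s then t 0 else Set.univ)) *
      ∏ i ∈ s', G.raceLaw (t (i + 1)) := by
    have h1 : ∏ i ∈ s.erase 0, G.raceLaw (t i) = ∏ i ∈ s', G.raceLaw (t (i + 1)) := by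
      rw [hs', Finset.prod_image]
      · refine Finset.prod_congr rfl fun i hi => ?_
        have h0 := (Finset.mem_erase.1 hi).1
        rw [Nat.pred_eq_sub_one, Nat.sub_add_cancel (Nat.pos_of_ne_zero h0)]
      · intro i hi j hj hij
        have h0 := (Finset.mem_erase.1 hi).1
        have h1 := (Finset.mem_erase.1 hj).1
        simp only [Nat.pred_eq_sub_one] at hij
        omega
    rw [← h1]
    split_ifs with h0
    · exact (Finset.mul_prod_erase s (fun i => G.raceLaw (t i)) h0).symm
    · rw [measure_univ, one_mul, Finset.erase_eq_of_notMem h0]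
  rw [e, Measure.prod_prod, hprod, racesLaw, Measure.infinitePi_pi _ fun i _ => ht (i + 1)]

lemma measurePreserving_consRace :
    MeasurePreserving (fun q : (Fin 2 × ℝ) × Races => consRace q.1 q.2)
      (G.raceLaw.prod G.racesLaw) G.racesLaw := ⟨measurable_consRace, map_consRace⟩

/-- First step analysis for events that do not depend on the duration of the first race. -/
lemma racesLaw_first_step {S : Set Races} (hS : MeasurableSet S) {S' : Fin 2 → Set Races}
    (h : ∀ a ω, consRace a ω ∈ S ↔ ω ∈ S' a.1) :
    G.racesLaw S = ∑ w, ENNReal.ofReal (G.winProb w) * G.racesLaw (S' w) := by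
  rw [← measurePreserving_consRace.measure_preimage hS.nullMeasurableSet,
    Measure.prod_apply (measurable_consRace hS), ← lintegral_raceLaw]
  refine lintegral_congr fun a => ?_
  congr 1
  ext ω
  exact h a ω

lemma integral_racesLaw {F : Races → ℝ} (hF : Integrable F G.racesLaw) :
    ∫ ω, F ω ∂G.racesLaw = ∫ a, ∫ ω, F (consRace a ω) ∂G.racesLaw ∂G.raceLaw := by
  have h1 := (integrable_map_measure (μ := G.raceLaw.prod G.racesLaw) (g := F)
    (by rw [map_consRace]; exact hF.aestronglyMeasurable) measurable_consRace.aemeasurable).1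
    (by rwa [map_consRace])
  have h2 := integral_map (μ := G.raceLaw.prod G.racesLaw) (f := F)
    measurable_consRace.aemeasurable (by rw [map_consRace]; exact hF.aestronglyMeasurable)
  rw [map_consRace] at h2
  rw [h2]
  exact integral_prod _ h1

/-- First step analysis for expectations that do not depend on the duration of the first race. -/
lemma integral_first_step {F : Races → ℝ} (hF : Integrable F G.racesLaw) {F' : Fin 2 → Races → ℝ}
    (h : ∀ a ω, F (consRace a ω) = F' a.1 ω) :
    ∫ ω, F ω ∂G.racesLaw = ∑ w, G.winProb w * ∫ ω, F' w ω ∂G.racesLaw := by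
  rw [integral_racesLaw hF]
  simp only [h]
  rw [integral_raceLaw (f := fun a => ∫ ω, F' a.1 ω ∂G.racesLaw)
    ((Measurable.of_discrete (f := fun w => ∫ ω, F' w ω ∂G.racesLaw)).comp measurable_fst)
    fun w => integrable_const (∫ ω, F' w ω ∂G.racesLaw)]
  simp

/-- Such an `F` factors through the finite set of winner words of length `n`, so neither a growth
bound nor a separate measurability proof is needed. Durations and later winners are filled in
arbitrarily. -/
lemma integrable_of_winners (n : ℕ) {F : Races → ℝ}
    (h : ∀ ω ω' : Races, (∀ k < n, (ω k).1 = (ω' k).1) → F ω = F ω') :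
    Integrable F G.racesLaw := by
  let e : Races → (Fin n → Fin 2) := fun ω k => (ω k).1
  have he : Measurable e := measurable_pi_lambda _ fun k =>
    measurable_fst.comp (measurable_pi_apply _)
  let Φ : (Fin n → Fin 2) → ℝ := fun v =>
    F fun k => (if hk : k < n then v ⟨k, hk⟩ else 0, 0)
  have hΦ : F = Φ ∘ e := by
    funext ω
    exact h _ _ fun k hk => by simp [e, hk]
  have : IsProbabilityMeasure (G.racesLaw.map e) := Measure.isProbabilityMeasure_map he.aemeasurable
  have hi : Integrable Φ (G.racesLaw.map e) := Integrable.of_finite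
  rw [hΦ]
  exact hi.comp_measurable he

variable (G) in
/-- The chain started at `x` and driven by `ω`. -/
def path (x : G.State) (ω : Races) (n : ℕ) : G.State := G.X n (x, ω)

lemma path_zero (x : G.State) (ω : Races) : G.path x ω 0 = x := rfl

lemma path_succ (x : G.State) (ω : Races) (n : ℕ) :
    G.path x ω (n + 1) = G.step (G.path x ω n) (ω n).1 := rfl

lemma path_consRace (x : G.State) (a : Fin 2 × ℝ) (ω : Races) (n : ℕ) :
    G.path x (consRace a ω) (n + 1) = G.path (G.step x a.1) ω n := by
  induction n with
  | zero => rfl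
  | succ n ih => rw [path_succ, ih, path_succ]; rfl

lemma path_congr (x : G.State) {ω ω' : Races} {n : ℕ} (h : ∀ k < n, (ω k).1 = (ω' k).1) :
    G.path x ω n = G.path x ω' n := by
  induction n with
  | zero => rfl
  | succ n ih =>
    rw [path_succ, path_succ, ih fun k hk => h k (hk.trans n.lt_succ_self), h n n.lt_succ_self]

variable (G) in
/-- The sum of `φ` along the first `n` turns. -/
def pathSum (φ : G.State → Fin 2 → ℝ) (n : ℕ) (x : G.State) (ω : Races) : ℝ :=
  ∑ k ∈ Finset.range n, φ (G.path x ω k) (ω k).1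

variable {φ : G.State → Fin 2 → ℝ}

lemma pathSum_consRace (n : ℕ) (x : G.State) (a : Fin 2 × ℝ) (ω : Races) :
    G.pathSum φ (n + 1) x (consRace a ω) = φ x a.1 + G.pathSum φ n (G.step x a.1) ω := by
  simp only [pathSum]
  rw [Finset.sum_range_succ', add_comm]
  simp only [path_consRace]
  rfl

lemma pathSum_congr (x : G.State) {ω ω' : Races} {n : ℕ} (h : ∀ k < n, (ω k).1 = (ω' k).1) :
    G.pathSum φ n x ω = G.pathSum φ n x ω' :=
  Finset.sum_congr rfl fun k hk => by
    have hk := Finset.mem_range.1 hk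
    rw [path_congr x fun j hj => h j (hj.trans hk), h k hk]

/-- Functions of the path sum and of the final state are integrable for a fixed initial state. -/
lemma integrable_pathSum (n : ℕ) (x : G.State) (F : ℝ → G.State → ℝ) :
    Integrable (fun ω => F (G.pathSum φ n x ω) (G.path x ω n)) G.racesLaw :=
  integrable_of_winners n fun ω ω' h => by rw [pathSum_congr x h, path_congr x h]

/-- A Feynman–Kac formula by first step analysis. It is used with weight one, with `avoid m` and
with `exp (-totalReward)`. -/
lemma integral_prod_path (κ : G.State → Fin 2 → ℝ) (f : G.State → ℝ) (n : ℕ) (x : G.State) :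
    ∫ ω, (∏ k ∈ Finset.range n, κ (G.path x ω k) (ω k).1) * f (G.path x ω n) ∂G.racesLaw =
      (G.weightedOp κ ^ n) f x := by
  induction n generalizing x with
  | zero => simp [path_zero]
  | succ n ih =>
    rw [integral_first_step (F' := fun w ω => κ x w *
      ((∏ k ∈ Finset.range n, κ (G.path (G.step x w) ω k) (ω k).1) * f (G.path (G.step x w) ω n))),
      weightedOp_pow_succ]
    · simp only [integral_const_mul, ih]
    · refine integrable_of_winners (n + 1) fun ω ω' h => ?_
      rw [path_congr x h, Finset.prod_congr rfl fun k hk => ?_]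
      have hk := Finset.mem_range.1 hk
      rw [path_congr x fun j hj => h j (hj.trans hk), h k hk]
    · intro a ω
      rw [Finset.prod_range_succ', path_consRace, mul_comm (∏ k ∈ _, _) _, mul_assoc]
      simp only [path_consRace]
      rfl

lemma integral_path (f : G.State → ℝ) (n : ℕ) (x : G.State) :
    ∫ ω, f (G.path x ω n) ∂G.racesLaw = (G.transOp ^ n) f x := by
  have := integral_prod_path (fun _ _ => 1) f n x
  simp only [Finset.prod_const_one, one_mul] at this
  exact this

end MiningGame

end

/-! ### Law of large numbers in mean and expectations of reciprocals -/

section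

namespace MiningGame

variable {G : MiningGame} {φ : G.State → Fin 2 → ℝ} {K g p : ℕ}

lemma integral_pathSum_eq_zero (h0 : ∀ x, ∑ w, G.winProb w * φ x w = 0) (n : ℕ) (x : G.State) :
    ∫ ω, G.pathSum φ n x ω ∂G.racesLaw = 0 := by
  induction n generalizing x with
  | zero => simp [pathSum]
  | succ n ih =>
    rw [integral_first_step (integrable_pathSum _ x fun s _ => s)
      (F' := fun w ω => φ x w + G.pathSum φ n (G.step x w) ω) (pathSum_consRace n x), ← h0 x]
    refine Finset.sum_congr rfl fun w _ => ?_
    rw [integral_add (integrable_const _) (integrable_pathSum _ _ fun s _ => s), ih]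
    simp

/-- The increments are centred, so the cross term of the first step vanishes and the second moments
satisfy `u (n + 1) = ψ + transOp (u n)`. By `transOp_pot_le` the right side of the claim is a
supersolution of this recursion. -/
lemma integral_pathSum_sq_le (hK : G.HitsBase K) (h0 : ∀ x, ∑ w, G.winProb w * φ x w = 0)
    (hφ : HasGrowth p fun x => ∑ w, G.winProb w * φ x w ^ 2) (n : ℕ) (x : G.State) :
    ∫ ω, G.pathSum φ n x ω ^ 2 ∂G.racesLaw ≤
      G.pot (fun x => ∑ w, G.winProb w * φ x w ^ 2) x +
        n * G.pot (fun x => ∑ w, G.winProb w * φ x w ^ 2) G.base := by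
  set ψ : G.State → ℝ := fun x => ∑ w, G.winProb w * φ x w ^ 2 with hψ
  have hψ0 : 0 ≤ ψ := fun x =>
    Finset.sum_nonneg fun w _ => mul_nonneg (G.winProb_pos w).le (sq_nonneg _)
  induction n generalizing x with
  | zero => simpa [pathSum] using pot_nonneg hψ0 x
  | succ n ih =>
    rw [integral_first_step (integrable_pathSum _ x fun s _ => s ^ 2)
      (F' := fun w ω => (φ x w + G.pathSum φ n (G.step x w) ω) ^ 2)
      fun a ω => by rw [pathSum_consRace]]
    have hw : ∀ w, ∫ ω, (φ x w + G.pathSum φ n (G.step x w) ω) ^ 2 ∂G.racesLaw =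
        φ x w ^ 2 + ∫ ω, G.pathSum φ n (G.step x w) ω ^ 2 ∂G.racesLaw := fun w => by
      have i1 := integrable_pathSum (φ := φ) n (G.step x w) fun s _ => 2 * φ x w * s
      have i2 := integrable_pathSum (φ := φ) n (G.step x w) fun s _ => s ^ 2
      have i3 : Integrable (fun ω => φ x w ^ 2 + 2 * φ x w * G.pathSum φ n (G.step x w) ω)
          G.racesLaw := (integrable_const _).add i1
      simp only [add_sq]
      rw [integral_add i3 i2, integral_add (integrable_const _) i1,
        integral_const_mul, integral_pathSum_eq_zero h0]
      simp
    simp only [hw]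
    calc ∑ w, G.winProb w * (φ x w ^ 2 + ∫ ω, G.pathSum φ n (G.step x w) ω ^ 2 ∂G.racesLaw)
        ≤ ∑ w, G.winProb w * (φ x w ^ 2 + (G.pot ψ (G.step x w) + n * G.pot ψ G.base)) := by
          refine Finset.sum_le_sum fun w _ => mul_le_mul_of_nonneg_left ?_ (G.winProb_pos w).le
          exact add_le_add le_rfl (ih _)
      _ = ψ x + G.transOp (G.pot ψ) x + n * G.pot ψ G.base := by
          simp only [mul_add, Finset.sum_add_distrib, ← Finset.sum_mul, G.winProb_sum, one_mul,
            transOp_apply, hψ, add_assoc]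
      _ ≤ G.pot ψ x + ((n + 1 : ℕ) : ℝ) * G.pot ψ G.base := by
          have := transOp_pot_le hK hφ hψ0 x
          push_cast
          linarith

lemma HasGrowth.le {f : G.State → ℝ} (hf : HasGrowth p f) :
    ∃ c, 0 ≤ c ∧ ∀ x, f x ≤ c * size x ^ p := by
  obtain ⟨c, hc, h⟩ := hf
  exact ⟨c, hc, fun x => (le_abs_self _).trans (h x)⟩

lemma HasGrowth.sum_winProb {f : G.State → Fin 2 → ℝ} (hf : ∀ w, HasGrowth p fun x => f x w) :
    HasGrowth p fun x => ∑ w, G.winProb w * f x w := by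
  refine (((hf 0).smul (G.winProb 0)).add ((hf 1).smul (G.winProb 1))).of_le fun x => ?_
  rw [Fin.sum_univ_two]
  rfl

/-- Law of large numbers in `L¹`, with a rate. -/
lemma exists_L1_bound (hK : G.HitsBase K) {r : G.State → Fin 2 → ℝ}
    (hr : ∀ w, HasGrowth 1 fun x => r x w) :
    ∃ C, 0 ≤ C ∧ ∀ (n : ℕ) (x : G.State),
      ∫ ω, |G.pathSum r n x ω - n * G.mean fun x => ∑ w, G.winProb w * r x w| ∂G.racesLaw ≤
        C * size x * √(n + 1) := by
  set f : G.State → ℝ := fun x => ∑ w, G.winProb w * r x w with hf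
  have hfg : HasGrowth 1 f := HasGrowth.sum_winProb hr
  set h := G.poisson f with hh
  have hhg : HasGrowth 1 h := hfg.poisson hK
  set c := G.mean f with hc
  -- The martingale increments: the Poisson equation says exactly that they are centred given the
  -- state.
  set φ : G.State → Fin 2 → ℝ := fun x w => r x w - c + (h (G.step x w) - h x) with hφ
  have hφ0 : ∀ x, ∑ w, G.winProb w * φ x w = 0 := fun x => by
    have h1 := poisson_sub_transOp hK hfg x
    have h2 := G.winProb_sum
    rw [transOp_apply] at h1
    simp only [hφ, mul_add, mul_sub, Finset.sum_add_distrib, Finset.sum_sub_distrib,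
      ← Finset.sum_mul, h2, one_mul]
    change f x - c + (_ - h x) = 0
    linarith
  have hφg : ∀ w, HasGrowth 1 fun x => φ x w := fun w =>
    ((hr w).sub (hasGrowth_const 1 c)).add ((hhg.comp_step w).sub hhg)
  have hψg : HasGrowth 2 fun x => ∑ w, G.winProb w * φ x w ^ 2 :=
    HasGrowth.sum_winProb fun w => (hφg w).sq
  obtain ⟨c2, hc2, hu⟩ := (hψg.pot hK).le
  obtain ⟨c4, hc4, hv⟩ := (hhg.abs.pot hK).le
  obtain ⟨c6, hc6, hh6⟩ := hhg
  set ψ : G.State → ℝ := fun x => ∑ w, G.winProb w * φ x w ^ 2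
  set c3 := c2 * size G.base ^ 2
  set c5 := c4 * size G.base ^ 1
  have hc3 : 0 ≤ c3 := by positivity
  have hc5 : 0 ≤ c5 := mul_nonneg hc4 (pow_nonneg (size_pos _).le _)
  -- Three contributions: the martingale, the Poisson solution at the final state and its value at
  -- the initial state.
  refine ⟨(c2 + c3 + 1) / 2 + (c4 + c5) + c6, by positivity, fun n x => ?_⟩
  set s := size x * √(n + 1) with hs
  have hx := one_le_size x
  have hsq : 1 ≤ √((n : ℝ) + 1) := by
    rw [Real.one_le_sqrt]; linarith [(n.cast_nonneg : (0 : ℝ) ≤ n)]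
  have hxs : size x ≤ s := le_mul_of_one_le_right (by linarith) hsq
  have hs1 : 1 ≤ s := hx.trans hxs
  have hs2 : s ^ 2 = size x ^ 2 * (n + 1) := by
    rw [hs, mul_pow, Real.sq_sqrt (by positivity)]
  have hM : ∫ ω, |G.pathSum φ n x ω| ∂G.racesLaw ≤ (c2 + c3 + 1) / 2 * s := by
    -- The second moment is turned into a first moment by `|M| ≤ M ^ 2 / (2 * s) + s / 2`, with `s`
    -- of the order of the standard deviation.
    have hpt : ∀ ω, |G.pathSum φ n x ω| ≤ (2 * s)⁻¹ * G.pathSum φ n x ω ^ 2 + s / 2 := fun ω => by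
      have : (2 * s)⁻¹ * G.pathSum φ n x ω ^ 2 + s / 2 - |G.pathSum φ n x ω| =
          (2 * s)⁻¹ * (|G.pathSum φ n x ω| - s) ^ 2 := by
        rw [← sq_abs]; field_simp; ring
      have h2 : 0 ≤ (2 * s)⁻¹ * (|G.pathSum φ n x ω| - s) ^ 2 := by positivity
      linarith
    have i2 := integrable_pathSum (φ := φ) n x fun s' _ => (2 * s)⁻¹ * s' ^ 2
    have h1 := integral_mono (integrable_pathSum (φ := φ) n x fun s _ => |s|)
      (i2.add (integrable_const (s / 2))) hpt
    rw [integral_add' i2 (integrable_const _), integral_const_mul] at h1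
    have h3 : ∫ ω, G.pathSum φ n x ω ^ 2 ∂G.racesLaw ≤ (c2 + c3) * s ^ 2 := by
      refine (integral_pathSum_sq_le hK hφ0 hψg n x).trans ?_
      have a1 := hu x
      have a2 := hu G.base
      have hn : (0 : ℝ) ≤ n := n.cast_nonneg
      have hx2 : 1 ≤ size x ^ 2 := one_le_pow₀ hx
      rw [hs2]
      calc G.pot ψ x + n * G.pot ψ G.base ≤ c2 * size x ^ 2 + n * c3 := by gcongr
        _ ≤ c2 * (size x ^ 2 * (n + 1)) + (size x ^ 2 * (n + 1)) * c3 := by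
            gcongr
            · exact le_mul_of_one_le_right (by positivity) (by linarith)
            · nlinarith
        _ = _ := by ring
    refine h1.trans ?_
    simp only [integral_const, probReal_univ, one_smul]
    calc (2 * s)⁻¹ * ∫ ω, G.pathSum φ n x ω ^ 2 ∂G.racesLaw + s / 2
        ≤ (2 * s)⁻¹ * ((c2 + c3) * s ^ 2) + s / 2 := by gcongr
      _ = _ := by field_simp
  have hH : ∫ ω, |h (G.path x ω n)| ∂G.racesLaw ≤ (c4 + c5) * s := by
    rw [integral_path (fun y => |h y|)]
    have hgabs : HasGrowth 1 fun y => |h y| := ⟨c6, hc6, fun y => by simpa using hh6 y⟩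
    refine (transOp_pow_le hK hgabs (fun y => abs_nonneg _) n x).trans ?_
    have a1 := hv x
    have a2 := hv G.base
    rw [pow_one] at a1
    calc _ ≤ c4 * size x + c5 := add_le_add a1 a2
      _ ≤ c4 * s + c5 * s := by
          gcongr
          exact le_mul_of_one_le_right hc5 hs1
      _ = _ := by ring
  have hsplit : ∀ ω, |G.pathSum r n x ω - n * c| ≤
      |G.pathSum φ n x ω| + |h (G.path x ω n)| + c6 * s := fun ω => by
    have e : G.pathSum φ n x ω = G.pathSum r n x ω - n * c + (h (G.path x ω n) - h x) := by
      have := Finset.sum_range_sub (fun k => h (G.path x ω k)) n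
      simp only [path_succ] at this
      simp only [pathSum, hφ, Finset.sum_add_distrib, Finset.sum_sub_distrib, this] at this ⊢
      simp [path_zero]
    have h6 : |h x| ≤ c6 * s := (hh6 x).trans (by rw [pow_one]; gcongr)
    rw [show G.pathSum r n x ω - n * c = G.pathSum φ n x ω - h (G.path x ω n) + h x by
      rw [e]; ring]
    exact (abs_add_le _ _).trans (add_le_add (abs_sub _ _) h6)
  have i1 := integrable_pathSum (φ := φ) n x fun s _ => |s|
  have i2 := integrable_pathSum (φ := φ) n x fun _ y => |h y|
  have := integral_mono (integrable_pathSum (φ := r) n x fun s _ => |s - n * c|)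
    ((i1.add i2).add (integrable_const (c6 * s))) hsplit
  rw [integral_add' (i1.add i2) (integrable_const _), integral_add' i1 i2] at this
  simp only [integral_const, probReal_univ, one_smul] at this
  refine this.trans ?_
  calc _ ≤ (c2 + c3 + 1) / 2 * s + (c4 + c5) * s + c6 * s := by gcongr
    _ = _ := by rw [hs]; ring

lemma integrable_duration (k : ℕ) : Integrable (fun ω : Races => (ω k).2) G.racesLaw := by
  have h1 : Integrable (fun a : Fin 2 × ℝ => a.2) G.raceLaw :=
    (integrable_id_expMeasure G.rate_pos).comp_snd G.winnerLaw
  exact (measurePreserving_eval_infinitePi (fun _ : ℕ => G.raceLaw) k).integrable_comp_of_integrable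
    h1

/-- The durations are independent of the winners, hence of the path sum, so each contributes its
mean `rate⁻¹`. The offset `b` stores what earlier turns have added to the sum, as the induction on
the first race requires. -/
lemma integral_durations_mul {ζ : ℝ → ℝ} (hζ : ∀ s, |ζ s| ≤ 1) (n : ℕ) (x : G.State) (b : ℝ) :
    ∫ ω, (∑ k ∈ Finset.range n, (ω k).2) * ζ (b + G.pathSum φ n x ω) ∂G.racesLaw =
      n * G.rate⁻¹ * ∫ ω, ζ (b + G.pathSum φ n x ω) ∂G.racesLaw := by
  induction n generalizing x b with
  | zero => simp
  | succ n ih =>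
    have hi : ∀ (m : ℕ) (y : G.State) (d : ℝ), Integrable
        (fun ω => (∑ k ∈ Finset.range m, (ω k).2) * ζ (d + G.pathSum φ m y ω)) G.racesLaw :=
      fun m y d => (integrable_finsetSum _ fun k _ => integrable_duration k).mul_bdd (c := 1)
        (integrable_pathSum (φ := φ) m y fun s _ => ζ (d + s)).aestronglyMeasurable
        (ae_of_all _ fun ω => hζ _)
    have hz := fun w => integrable_pathSum (φ := φ) n (G.step x w) fun s _ => ζ (b + φ x w + s)
    have hY : ∀ a, ∫ ω, (∑ k ∈ Finset.range (n + 1), (consRace a ω k).2) *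
        ζ (b + G.pathSum φ (n + 1) x (consRace a ω)) ∂G.racesLaw =
        (a.2 + n * G.rate⁻¹) *
          ∫ ω, ζ (b + φ x a.1 + G.pathSum φ n (G.step x a.1) ω) ∂G.racesLaw := fun a => by
      rw [add_mul, ← ih, ← integral_const_mul, ← integral_add ((hz a.1).const_mul _) (hi n _ _)]
      refine integral_congr_ae (ae_of_all _ fun ω => ?_)
      simp only
      rw [Finset.sum_range_succ', pathSum_consRace, ← add_assoc, ← add_mul, add_comm (a.2)]
      rfl
    -- The remaining expectation depends on the first race only through its winner; naming it makes
    -- the integrand an explicit function of winner and duration.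
    obtain ⟨Z, hZ⟩ : ∃ Z : Fin 2 → ℝ, ∀ w,
        ∫ ω, ζ (b + φ x w + G.pathSum φ n (G.step x w) ω) ∂G.racesLaw = Z w :=
      ⟨_, fun _ => rfl⟩
    rw [integral_racesLaw (hi (n + 1) x b)]
    simp only [hY, hZ]
    rw [integral_raceLaw, integral_first_step
      (F' := fun w ω => ζ (b + φ x w + G.pathSum φ n (G.step x w) ω))
      (integrable_pathSum (φ := φ) (n + 1) x fun s _ => ζ (b + s))
      fun a ω => by rw [pathSum_consRace, ← add_assoc], Finset.mul_sum]
    · refine Finset.sum_congr rfl fun w _ => ?_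
      rw [hZ]
      dsimp only
      rw [integral_mul_const, integral_add (integrable_id_expMeasure G.rate_pos)
        (integrable_const _), integral_id_expMeasure G.rate_pos]
      simp only [integral_const, probReal_univ, one_smul]
      push_cast
      ring
    · exact (measurable_snd.add_const _).mul (Measurable.of_discrete.comp measurable_fst)
    · intro w
      have i : Integrable (fun t => t + n * G.rate⁻¹) (expMeasure G.rate) :=
        (integrable_id_expMeasure G.rate_pos).add (integrable_const _)
      have i' : Integrable (fun t => (t + n * G.rate⁻¹) * Z w) (expMeasure G.rate) :=
        i.mul_const (Z w)
      dsimp only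
      exact i'

lemma tendsto_sqrt_div : Tendsto (fun n : ℕ => √((n : ℝ) + 1) / n) atTop (𝓝 0) := by
  have h1 : Tendsto (fun n : ℕ => (1 / (n : ℝ)) + (1 / (n : ℝ)) ^ 2) atTop (𝓝 0) := by
    have := tendsto_one_div_atTop_nhds_zero_nat (𝕜 := ℝ)
    simpa using this.add (this.pow 2)
  have h2 := (Real.continuous_sqrt.tendsto _).comp h1
  rw [Real.sqrt_zero] at h2
  refine h2.congr fun n => ?_
  rcases Nat.eq_zero_or_pos n with rfl | hn
  · simp
  · have hn' : (0 : ℝ) < n := by exact_mod_cast hn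
    have e : (1 / (n : ℝ)) + (1 / (n : ℝ)) ^ 2 = (n + 1) / n ^ 2 := by field_simp
    rw [Function.comp_apply, e, Real.sqrt_div' _ (by positivity), Real.sqrt_sq hn'.le]

lemma Feasible.pathSum_nonneg (hF : G.Feasible) (n : ℕ) (x : G.State) (ω : Races) :
    0 ≤ G.pathSum G.totalReward n x ω :=
  Finset.sum_nonneg fun _ _ => hF.totalReward_nonneg _ _

variable (G) in
/-- The long-run average of the number of blocks validated in a turn. -/
def meanDist : ℝ := G.mean (G.rhat 0) + G.mean (G.rhat 1)

lemma exists_L1_bound_reward (hK : G.HitsBase K) (i : Fin 2) :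
    ∃ C, 0 ≤ C ∧ ∀ (n : ℕ) (x : G.State),
      ∫ ω, |G.pathSum (G.reward i) n x ω - n * G.mean (G.rhat i)| ∂G.racesLaw ≤
        C * size x * √(n + 1) := by
  have e : (fun x => ∑ w, G.winProb w * G.reward i x w) = G.rhat i :=
    funext fun x => (rhat_eq i x).symm
  have := exists_L1_bound hK (r := G.reward i) fun w =>
    ⟨1 + G.jump, by linarith [jump_pos (G := G)], fun x => by
      rw [pow_one]; exact abs_reward_le i x w⟩
  rwa [e] at this

lemma exists_L1_bound_totalReward (hK : G.HitsBase K) :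
    ∃ C, 0 ≤ C ∧ ∀ (n : ℕ) (x : G.State),
      ∫ ω, |G.pathSum G.totalReward n x ω - n * G.meanDist| ∂G.racesLaw ≤
        C * size x * √(n + 1) := by
  obtain ⟨C, hC, h⟩ := exists_L1_bound_reward hK (0 : Fin 2)
  obtain ⟨C', hC', h'⟩ := exists_L1_bound_reward hK (1 : Fin 2)
  refine ⟨C + C', by positivity, fun n x => ?_⟩
  have i0 := integrable_pathSum (φ := G.reward 0) n x fun s _ => |s - n * G.mean (G.rhat 0)|
  have i1 := integrable_pathSum (φ := G.reward 1) n x fun s _ => |s - n * G.mean (G.rhat 1)|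
  have := integral_mono (integrable_pathSum (φ := G.totalReward) n x
    fun s _ => |s - n * G.meanDist|) (i0.add i1) fun ω => by
      have e : G.pathSum G.totalReward n x ω =
          G.pathSum (G.reward 0) n x ω + G.pathSum (G.reward 1) n x ω := by
        simp only [pathSum, totalReward, Finset.sum_add_distrib]
      simp only [Pi.add_apply]
      rw [e, meanDist, mul_add, add_sub_add_comm]
      exact abs_add_le _ _
  rw [integral_add' i0 i1] at this
  linarith [h n x, h' n x]

/-- Exponential decay of the probability of validating few blocks. -/
lemma Feasible.exists_exp_bound (hF : G.Feasible) (hg : G.BoundedGap g) :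
    ∃ C ρ : ℝ, 0 < C ∧ 0 < ρ ∧ ρ < 1 ∧ ∀ (n : ℕ) (x : G.State),
      ∫ ω, Real.exp (-G.pathSum G.totalReward n x ω) ∂G.racesLaw ≤ C * ρ ^ n := by
  obtain ⟨K, hK⟩ := hg.exists_leaks_totalReward hF
  obtain ⟨C, ρ, hC, h0, h1, h⟩ := exists_geometric_bound (fun x w => (Real.exp_pos _).le)
    (fun x w => Real.exp_le_one_iff.2 (by linarith [hF.totalReward_nonneg x w]))
    (Real.exp_pos _).le (by rw [Real.exp_lt_one_iff]; norm_num) hK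
  refine ⟨C, ρ, hC, h0, h1, fun n x => ?_⟩
  have := integral_prod_path (fun x w => Real.exp (-G.totalReward x w)) 1 n x
  simp only [Pi.one_apply, mul_one] at this
  refine le_trans (le_of_eq ?_) (h n x)
  rw [← this]
  congr 1
  funext ω
  rw [pathSum, ← Finset.sum_neg_distrib, Real.exp_sum]

/-- The expectation of `n / (1 + ∑ dist)` is bounded uniformly in the initial state, and
converges. -/
lemma Feasible.inv_dist (hF : G.Feasible) (hg : G.BoundedGap g) :
    (∃ b : ℝ, ∀ (n : ℕ) (x : G.State),
      ∫ ω, n / (1 + G.pathSum G.totalReward n x ω) ∂G.racesLaw ≤ b) ∧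
    ∀ x : G.State, Tendsto
      (fun n : ℕ => ∫ ω, n / (1 + G.pathSum G.totalReward n x ω) ∂G.racesLaw) atTop
      (𝓝 G.meanDist⁻¹) := by
  obtain ⟨C, ρ, hC, hρ0, hρ1, hexp⟩ := hF.exists_exp_bound hg
  obtain ⟨K, hK⟩ := hg.exists_hitsBase
  obtain ⟨A, hA, hL1⟩ := exists_L1_bound_totalReward hK
  have hD : 0 < G.meanDist := hF.mean_rhat_pos hg
  set D := G.meanDist
  -- With this choice `σ = exp ε * ρ` is the square root of `ρ`, still below one. The threshold `ε *
  -- n` separates few validated blocks, an event treated by Chernoff's bound `hone`, from many.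
  set ε : ℝ := -Real.log ρ / 2 with hε
  have hε0 : 0 < ε := by have := Real.log_neg hρ0 hρ1; rw [hε]; linarith
  set σ := Real.exp ε * ρ with hσ
  have hσ0 : 0 < σ := by positivity
  have hσ1 : σ < 1 := by
    rw [hσ, ← Real.exp_log hρ0, ← Real.exp_add, Real.exp_lt_one_iff]
    rw [hε]; linarith [Real.log_neg hρ0 hρ1]
  have hσn : ∀ (n : ℕ) x, ∫ ω, Real.exp (ε * n) * Real.exp (-G.pathSum G.totalReward n x ω)
      ∂G.racesLaw ≤ C * σ ^ n := fun n x => by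
    rw [integral_const_mul, hσ, mul_pow, ← Real.exp_nat_mul, mul_comm ε]
    calc _ ≤ Real.exp (n * ε) * (C * ρ ^ n) := by gcongr; exact hexp n x
      _ = _ := by ring
  have hlim : Tendsto (fun n : ℕ => n * σ ^ n) atTop (𝓝 0) :=
    tendsto_self_mul_const_pow_of_lt_one hσ0.le hσ1
  have hlim' : Tendsto (fun n : ℕ => σ ^ n) atTop (𝓝 0) :=
    tendsto_pow_atTop_nhds_zero_of_lt_one hσ0.le hσ1
  have hi : ∀ (n : ℕ) x, Integrable (fun ω => Real.exp (ε * n) *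
      Real.exp (-G.pathSum G.totalReward n x ω)) G.racesLaw := fun n x =>
    integrable_pathSum n x fun s _ => Real.exp (ε * n) * Real.exp (-s)
  have hone : ∀ (n : ℕ) (s : ℝ), 1 + s < ε * n → 1 ≤ Real.exp (ε * n) * Real.exp (-s) :=
    fun n s h => by
      rw [← Real.exp_add]
      exact Real.one_le_exp (by linarith)
  constructor
  · obtain ⟨M, hM⟩ := hlim.bddAbove_range
    refine ⟨ε⁻¹ + C * M, fun n x => ?_⟩
    have hpt : ∀ ω, n / (1 + G.pathSum G.totalReward n x ω) ≤ ε⁻¹ +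
        n * (Real.exp (ε * n) * Real.exp (-G.pathSum G.totalReward n x ω)) := fun ω => by
      have hs := hF.pathSum_nonneg n x ω
      have hn : (0 : ℝ) ≤ n := n.cast_nonneg
      rcases lt_or_ge (1 + G.pathSum G.totalReward n x ω) (ε * n) with h | h
      · have h1 := hone n _ h
        have h2 : n / (1 + G.pathSum G.totalReward n x ω) ≤ n := div_le_self hn (by linarith)
        have h3 : 0 ≤ ε⁻¹ := by positivity
        nlinarith
      · have h1 : n / (1 + G.pathSum G.totalReward n x ω) ≤ ε⁻¹ := by
          rw [div_le_iff₀ (by linarith), ← div_eq_inv_mul, le_div_iff₀ hε0]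
          linarith
        have h2 : 0 ≤ n * (Real.exp (ε * n) * Real.exp (-G.pathSum G.totalReward n x ω)) := by
          positivity
        linarith
    have h1 := integral_mono (integrable_pathSum n x fun s _ => n / (1 + s))
      ((integrable_const _).add ((hi n x).const_mul (n : ℝ))) hpt
    rw [integral_add' (integrable_const _) ((hi n x).const_mul _), integral_const_mul] at h1
    simp only [integral_const, probReal_univ, one_smul] at h1
    have h2 := mul_le_mul_of_nonneg_left (hσn n x) (n.cast_nonneg (α := ℝ))
    have h3 : n * σ ^ n ≤ M := hM ⟨n, rfl⟩
    have h4 := mul_le_mul_of_nonneg_left h3 hC.le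
    linarith
  · intro x
    have hz : Tendsto (fun n : ℕ => (D * ε)⁻¹ * (A * size x * (√((n : ℝ) + 1) / n) + 1 / n) +
        (C * (n * σ ^ n) + D⁻¹ * (C * σ ^ n))) atTop (𝓝 0) := by
      have h1 := ((tendsto_sqrt_div.const_mul (A * size x)).add
        (tendsto_one_div_atTop_nhds_zero_nat (𝕜 := ℝ))).const_mul (D * ε)⁻¹
      have h2 := (hlim.const_mul C).add ((hlim'.const_mul C).const_mul D⁻¹)
      simpa using h1.add h2
    rw [tendsto_iff_norm_sub_tendsto_zero]
    refine squeeze_zero' (Eventually.of_forall fun _ => norm_nonneg _) ?_ hz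
    filter_upwards [eventually_gt_atTop 0] with n hn
    have hn' : (0 : ℝ) < n := by exact_mod_cast hn
    -- Above the threshold the denominator is at least `ε * n` and the error is controlled by the
    -- law of large numbers; below it the crude bound `n + D⁻¹` is paid, against an exponentially
    -- small factor.
    have hpt : ∀ ω, |n / (1 + G.pathSum G.totalReward n x ω) - D⁻¹| ≤
        (D * ε * n)⁻¹ * (|G.pathSum G.totalReward n x ω - n * D| + 1) + (n + D⁻¹) *
          (Real.exp (ε * n) * Real.exp (-G.pathSum G.totalReward n x ω)) := fun ω => by
      have hs := hF.pathSum_nonneg n x ω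
      set s := G.pathSum G.totalReward n x ω
      have hD' : 0 < D⁻¹ := by positivity
      rcases lt_or_ge (1 + s) (ε * n) with h | h
      · have h1 := hone n _ h
        have h2 : n / (1 + s) ≤ n := div_le_self hn'.le (by linarith)
        have h3 : 0 ≤ n / (1 + s) := by positivity
        have h4 : |n / (1 + s) - D⁻¹| ≤ n + D⁻¹ := by rw [abs_le]; constructor <;> linarith
        have h5 : 0 ≤ (D * ε * n)⁻¹ * (|s - n * D| + 1) := by positivity
        nlinarith
      · have e : n / (1 + s) - D⁻¹ = (D * (1 + s))⁻¹ * (n * D - s - 1) := by field_simp; ring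
        have h1 : (D * (1 + s))⁻¹ ≤ (D * ε * n)⁻¹ := by
          rw [mul_assoc]
          gcongr
        have h2 : |n * D - s - 1| ≤ |s - n * D| + 1 := by
          rw [abs_sub_comm s]
          simpa using abs_sub (n * D - s) 1
        have h3 : 0 ≤ (n + D⁻¹) * (Real.exp (ε * n) * Real.exp (-s)) := by positivity
        rw [e, abs_mul, abs_of_pos (by positivity)]
        have := mul_le_mul h1 h2 (abs_nonneg _) (by positivity)
        linarith
    have i0 := integrable_pathSum (φ := G.totalReward) n x fun s _ => n / (1 + s)
    have i1 := integrable_pathSum (φ := G.totalReward) n x fun s _ => |s - n * D|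
    have i2 := (i1.add (integrable_const (1 : ℝ))).const_mul (D * ε * n)⁻¹
    have i3 := (hi n x).const_mul (n + D⁻¹)
    have h1 := integral_mono (i0.sub (integrable_const D⁻¹)).abs (i2.add i3) hpt
    have h2 := abs_integral_le_integral_abs (μ := G.racesLaw)
      (f := fun ω => n / (1 + G.pathSum G.totalReward n x ω) - D⁻¹)
    rw [integral_sub i0 (integrable_const _)] at h2
    rw [integral_add' i2 i3, integral_const_mul, integral_const_mul,
      integral_add' i1 (integrable_const _)] at h1
    simp only [integral_const, probReal_univ, one_smul] at h1 h2
    refine (h2.trans h1).trans ?_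
    calc _ ≤ (D * ε * n)⁻¹ * (A * size x * √(n + 1) + 1) + (n + D⁻¹) * (C * σ ^ n) := by
          gcongr
          · exact hL1 n x
          · exact hσn n x
      _ = _ := by field_simp

end MiningGame

end

/-! ### Irreducibility, positive recurrence and the geometric bound for the return time -/

section

namespace MiningGame

variable {G : MiningGame} {g K : ℕ}

lemma measurable_winner (n : ℕ) : Measurable (G.winner n) :=
  measurable_fst.comp ((measurable_pi_apply n).comp measurable_snd)

lemma measurable_X (n : ℕ) : Measurable (G.X n) := by
  induction n with
  | zero => exact measurable_fst
  | succ n ih =>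
    exact (Measurable.of_discrete (f := fun q : G.State × Fin 2 => G.step q.1 q.2)).comp
      (ih.prodMk (measurable_winner n))

lemma measurable_path (x : G.State) (n : ℕ) : Measurable fun ω => G.path x ω n :=
  (measurable_X n).comp measurable_prodMk_left

lemma measurable_r (i : Fin 2) (n : ℕ) : Measurable (G.r i n) :=
  (Measurable.of_discrete (f := fun q : G.State × Fin 2 => G.reward i q.1 q.2)).comp
    ((measurable_X n).prodMk (measurable_winner n))

lemma measurable_dist (n : ℕ) : Measurable (G.dist n) := (measurable_r 0 n).add (measurable_r 1 n)

lemma law_dirac (x : G.State) : G.law (Measure.dirac x) = G.racesLaw.map (Prod.mk x) :=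
  Measure.dirac_prod x

lemma law_dirac_apply (x : G.State) {S : Set G.Omega} (hS : MeasurableSet S) :
    G.law (Measure.dirac x) S = G.racesLaw {ω | (x, ω) ∈ S} := by
  rw [law_dirac, Measure.map_apply measurable_prodMk_left hS]
  rfl

lemma isIrreducible (hg : G.BoundedGap g) : G.IsIrreducible := by
  intro m m'
  obtain ⟨K, hK⟩ := hg.exists_run m'
  obtain ⟨l, -, -, hl⟩ := hK m
  refine ⟨l.length, ?_⟩
  have hp := transOp_pow_single_pos hl
  rw [← integral_path] at hp
  have hS : MeasurableSet {ω | G.X l.length ω = m'} :=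
    (measurable_X _) (measurableSet_singleton m')
  rw [law_dirac_apply m hS, pos_iff_ne_zero]
  intro h0
  refine hp.ne' (integral_eq_zero_of_ae ?_)
  have : ∀ᵐ ω ∂G.racesLaw, G.path m ω l.length ≠ m' := by
    rw [ae_iff]
    simp only [not_not]
    exact h0
  filter_upwards [this] with ω hω
  simp [hω]

/-- The product of the weights `avoid m` along the path is the indicator of not entering `m`. -/
lemma racesLaw_avoid (m x : G.State) (n : ℕ) :
    G.racesLaw {ω | ∀ k < n, G.path x ω (k + 1) ≠ m} =
      ENNReal.ofReal ((G.weightedOp (G.avoid m) ^ n) 1 x) := by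
  have hS : MeasurableSet {ω | ∀ k < n, G.path x ω (k + 1) ≠ m} := by
    simp only [Set.ofPred_forall]
    exact MeasurableSet.iInter fun k => MeasurableSet.iInter fun _ =>
      (measurable_path x (k + 1)) (measurableSet_singleton m).compl
  have := integral_prod_path (G.avoid m) 1 n x
  simp only [Pi.one_apply, mul_one] at this
  rw [← this]
  have e : (fun ω => ∏ k ∈ Finset.range n, G.avoid m (G.path x ω k) (ω k).1) =
      {ω | ∀ k < n, G.path x ω (k + 1) ≠ m}.indicator 1 := by
    funext ω
    by_cases h : ω ∈ {ω | ∀ k < n, G.path x ω (k + 1) ≠ m}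
    · rw [Set.indicator_of_mem h]
      exact Finset.prod_eq_one fun k hk => if_neg (h k (Finset.mem_range.1 hk))
    · rw [Set.indicator_of_notMem h]
      simp only [Set.mem_ofPred_eq, not_forall, not_not] at h
      obtain ⟨k, hk, hm⟩ := h
      exact Finset.prod_eq_zero (Finset.mem_range.2 hk) (if_pos hm)
  rw [e, integral_indicator_one hS, ofReal_measureReal]

/-- The tail sum formula: the `n`-th event contains `{n < T}`, and the value `⊤` corresponds to a
divergent series of ones. -/
lemma passageTime_le_tsum (m : G.State) (ω : G.Omega) : (G.passageTime m ω : ENNReal) ≤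
    ∑' n : ℕ, {ω : G.Omega | ∀ k < n, G.X (k + 1) ω ≠ m}.indicator 1 ω := by
  have key : ∀ n : ℕ, (n : ℕ∞) < G.passageTime m ω →
      {ω : G.Omega | ∀ k < n, G.X (k + 1) ω ≠ m}.indicator (1 : G.Omega → ENNReal) ω = 1 := by
    intro n hn
    refine Set.indicator_of_mem (fun k hk hm => ?_) _
    have h1 : G.passageTime m ω ≤ ((k + 1 : ℕ) : ℕ∞) := iInf₂_le (k + 1) ⟨by omega, hm⟩
    have h2 : ((k + 1 : ℕ) : ℕ∞) ≤ n := by exact_mod_cast hk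
    exact absurd (hn.trans_le (h1.trans h2)) (lt_irrefl _)
  rcases h : G.passageTime m ω with _ | t
  · have : ∀ n : ℕ, {ω : G.Omega | ∀ k < n, G.X (k + 1) ω ≠ m}.indicator
        (1 : G.Omega → ENNReal) ω = 1 := fun n => key n (by rw [h]; exact ENat.natCast_lt_top n)
    simp only [this]
    rw [ENNReal.tsum_const_eq_top_of_ne_zero one_ne_zero]
    exact le_top
  · refine le_trans (le_of_eq ?_) (ENNReal.sum_le_tsum (Finset.range t))
    rw [Finset.sum_congr rfl fun n hn => key n (by
      rw [h]; exact ENat.natCast_lt_natCast.2 (Finset.mem_range.1 hn))]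
    simp
    rfl

lemma isPositiveRecurrent (hg : G.BoundedGap g) : G.IsPositiveRecurrent := by
  intro m
  obtain ⟨K, hK⟩ := hg.exists_leaks_avoid m
  obtain ⟨C, ρ, hC, h0, h1, hb⟩ := exists_geometric_bound (avoid_nonneg m) (avoid_le_one m) le_rfl
    zero_lt_one hK
  have hS : ∀ n : ℕ, MeasurableSet {ω : G.Omega | ∀ k < n, G.X (k + 1) ω ≠ m} := fun n => by
    simp only [Set.ofPred_forall]
    exact MeasurableSet.iInter fun k => MeasurableSet.iInter fun _ =>
      (measurable_X (k + 1)) (measurableSet_singleton m).compl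
  calc ∫⁻ ω, (G.passageTime m ω : ENNReal) ∂(G.law (Measure.dirac m))
      ≤ ∫⁻ ω, ∑' n : ℕ, {ω : G.Omega | ∀ k < n, G.X (k + 1) ω ≠ m}.indicator 1 ω
          ∂(G.law (Measure.dirac m)) := lintegral_mono (passageTime_le_tsum m)
    _ = ∑' n : ℕ, ENNReal.ofReal ((G.weightedOp (G.avoid m) ^ n) 1 m) := by
        rw [lintegral_tsum fun n => (measurable_one.indicator (hS n)).aemeasurable]
        refine tsum_congr fun n => ?_
        rw [lintegral_indicator_one (hS n), law_dirac_apply m (hS n), ← racesLaw_avoid]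
        rfl
    _ ≤ ∑' n : ℕ, ENNReal.ofReal (C * ρ ^ n) :=
        ENNReal.tsum_le_tsum fun n => ENNReal.ofReal_le_ofReal (hb n m)
    _ < ⊤ := by
        rw [← ENNReal.ofReal_tsum_of_nonneg (fun n => by positivity)
          ((summable_geometric_of_lt_one h0.le h1).mul_left C)]
        exact ENNReal.ofReal_lt_top

/-! ### Domination of the return time -/

/-- The sequence of races without its first `c` races. -/
def dropRaces (c : ℕ) (ω : Races) : Races := fun n => ω (n + c)

/-- Player 1 wins the first `c` races. -/
def winsFirst (c : ℕ) : Set Races := {ω | ∀ i < c, (ω i).1 = 0}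

lemma measurable_dropRaces (c : ℕ) : Measurable (dropRaces c) :=
  measurable_pi_lambda _ fun _ => measurable_pi_apply _

lemma measurableSet_winsFirst (c : ℕ) : MeasurableSet (winsFirst c) := by
  simp only [winsFirst, Set.ofPred_forall]
  exact MeasurableSet.iInter fun k => MeasurableSet.iInter fun _ =>
    (measurable_fst.comp (measurable_pi_apply k)) (measurableSet_singleton 0)

lemma racesLaw_dropRaces (c : ℕ) {S : Set Races} (hS : MeasurableSet S) :
    G.racesLaw (dropRaces c ⁻¹' S) = G.racesLaw S := by
  induction c with
  | zero => rfl
  | succ c ih =>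
    rw [racesLaw_first_step (measurable_dropRaces _ hS) (S' := fun _ => dropRaces c ⁻¹' S)
      fun _ _ => Iff.rfl, ih, ← Finset.sum_mul,
      ← ENNReal.ofReal_sum_of_nonneg fun w _ => (G.winProb_pos w).le, G.winProb_sum,
      ENNReal.ofReal_one, one_mul]

/-- Independence of the first `c` races from the later ones, obtained by removing one race at a
time. -/
lemma racesLaw_winsFirst_inter (c : ℕ) {S : Set Races} (hS : MeasurableSet S) :
    G.racesLaw (winsFirst c ∩ dropRaces c ⁻¹' S) =
      ENNReal.ofReal (G.p₁ : ℝ) ^ c * G.racesLaw S := by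
  induction c with
  | zero =>
    have : winsFirst 0 = Set.univ := by simp [winsFirst]
    rw [this, Set.univ_inter, pow_zero, one_mul]
    rfl
  | succ c ih =>
    rw [racesLaw_first_step ((measurableSet_winsFirst _).inter (measurable_dropRaces _ hS))
      (S' := fun w => {ω | w = 0 ∧ ω ∈ winsFirst c ∩ dropRaces c ⁻¹' S}), Fin.sum_univ_two]
    · simp only [true_and, Set.ofPred_mem_eq, ih, one_ne_zero, false_and, Set.ofPred_false,
        measure_empty, mul_zero, add_zero, pow_succ']
      rw [mul_assoc]
      rfl
    · intro a ω
      constructor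
      · rintro ⟨h1, h2⟩
        exact ⟨h1 0 (by omega), fun i hi => h1 (i + 1) (by omega), h2⟩
      · rintro ⟨h0, h1, h2⟩
        refine ⟨fun i hi => ?_, h2⟩
        cases i with
        | zero => exact h0
        | succ i => exact h1 i (by omega)

lemma racesLaw_diff_winsFirst (c : ℕ) {S : Set Races} (hS : MeasurableSet S) :
    G.racesLaw.real (dropRaces c ⁻¹' S \ winsFirst c) =
      (1 - (G.p₁ : ℝ) ^ c) * G.racesLaw.real S := by
  have h1 := measureReal_sdiff_add_inter (μ := G.racesLaw) (s := dropRaces c ⁻¹' S)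
    (measurableSet_winsFirst c)
  have h2 : G.racesLaw.real (dropRaces c ⁻¹' S ∩ winsFirst c) =
      (G.p₁ : ℝ) ^ c * G.racesLaw.real S := by
    rw [Set.inter_comm, measureReal_def, racesLaw_winsFirst_inter c hS, ENNReal.toReal_mul,
      ENNReal.toReal_pow, ENNReal.toReal_ofReal G.p₁.2.1]
    rfl
  have h3 : G.racesLaw.real (dropRaces c ⁻¹' S) = G.racesLaw.real S := by
    rw [measureReal_def, racesLaw_dropRaces c hS]
    rfl
  rw [h2, h3] at h1
  linarith

/-- Player 1 wins all races of block `j`, when the races are divided into blocks of length `c`. -/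
def winsBlock (c j : ℕ) : Set Races := {ω | ∀ i < c, (ω (j * c + i)).1 = 0}

/-- The first block all of whose races are won by player 1. -/
def firstWinsBlock (c : ℕ) (ω : Races) : ℕ := sInf {j | ω ∈ winsBlock c j}

/-- Block `k` is the first one all of whose races are won by player 1. -/
def firstAt (c k : ℕ) : Set Races := {ω | ω ∈ winsBlock c k ∧ ∀ j < k, ω ∉ winsBlock c j}

/-- Player 1 does not win all races of any block. -/
def neverWins (c : ℕ) : Set Races := {ω | ∀ j, ω ∉ winsBlock c j}

lemma measurableSet_winsBlock (c j : ℕ) : MeasurableSet (winsBlock c j) := by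
  simp only [winsBlock, Set.ofPred_forall]
  exact MeasurableSet.iInter fun k => MeasurableSet.iInter fun _ =>
    (measurable_fst.comp (measurable_pi_apply _)) (measurableSet_singleton 0)

lemma measurableSet_firstAt (c k : ℕ) : MeasurableSet (firstAt c k) := by
  simp only [firstAt, Set.ofPred_and, Set.ofPred_forall]
  exact (measurableSet_winsBlock c k).inter (MeasurableSet.iInter fun j =>
    MeasurableSet.iInter fun _ => (measurableSet_winsBlock c j).compl)

lemma measurableSet_neverWins (c : ℕ) : MeasurableSet (neverWins c) := by
  simp only [neverWins, Set.ofPred_forall]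
  exact MeasurableSet.iInter fun j => (measurableSet_winsBlock c j).compl

lemma winsBlock_zero (c : ℕ) : winsBlock c 0 = winsFirst c := by
  simp [winsBlock, winsFirst]

lemma mem_winsBlock_succ (c j : ℕ) (ω : Races) :
    ω ∈ winsBlock c (j + 1) ↔ dropRaces c ω ∈ winsBlock c j := by
  have : ∀ i, (j + 1) * c + i = j * c + i + c := fun i => by ring
  simp only [winsBlock, Set.mem_ofPred_eq, this]
  rfl

/-- Renewal: the first success is at block `k + 1` if the first block fails and, once it is dropped,
the first success is at block `k`. -/
lemma racesLaw_firstAt (c k : ℕ) :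
    G.racesLaw.real (firstAt c k) = (1 - (G.p₁ : ℝ) ^ c) ^ k * (G.p₁ : ℝ) ^ c := by
  induction k with
  | zero =>
    have h1 := racesLaw_winsFirst_inter (G := G) c MeasurableSet.univ
    have h2 : firstAt c 0 = winsFirst c ∩ dropRaces c ⁻¹' Set.univ := by
      simp [firstAt, winsBlock_zero]
    rw [h2, measureReal_def, h1, measure_univ, mul_one, ENNReal.toReal_pow,
      ENNReal.toReal_ofReal G.p₁.2.1, pow_zero, one_mul]
  | succ k ih =>
    have : firstAt c (k + 1) = dropRaces c ⁻¹' (firstAt c k) \ winsFirst c := by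
      ext ω
      simp only [firstAt, Set.mem_ofPred_eq, Set.mem_sdiff, Set.mem_preimage, ← winsBlock_zero,
        mem_winsBlock_succ]
      constructor
      · rintro ⟨h1, h2⟩
        exact ⟨⟨h1, fun j hj => by
          rw [← mem_winsBlock_succ]; exact h2 (j + 1) (by omega)⟩, h2 0 (by omega)⟩
      · rintro ⟨⟨h1, h2⟩, h3⟩
        refine ⟨h1, fun j hj => ?_⟩
        cases j with
        | zero => exact h3
        | succ j => rw [mem_winsBlock_succ]; exact h2 j (by omega)
    rw [this, racesLaw_diff_winsFirst c (measurableSet_firstAt c k), ih, pow_succ']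
    ring

/-- The same renewal shows that this probability `a` satisfies `a = (1 - p₁ ^ c) * a`. -/
lemma racesLaw_neverWins (c : ℕ) : G.racesLaw (neverWins c) = 0 := by
  have : neverWins c = dropRaces c ⁻¹' (neverWins c) \ winsFirst c := by
    ext ω
    simp only [neverWins, Set.mem_ofPred_eq, Set.mem_sdiff, Set.mem_preimage, ← winsBlock_zero,
      ← mem_winsBlock_succ]
    constructor
    · exact fun h => ⟨fun j => h (j + 1), h 0⟩
    · rintro ⟨h1, h2⟩ j
      cases j with
      | zero => exact h2
      | succ j => exact h1 j
  have h1 := racesLaw_diff_winsFirst (G := G) c (measurableSet_neverWins c)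
  rw [← this] at h1
  have hp : 0 < (G.p₁ : ℝ) ^ c := pow_pos (G.winProb_pos 0) c
  have h2 : G.racesLaw.real (neverWins c) = 0 := by
    have h3 : (G.p₁ : ℝ) ^ c * G.racesLaw.real (neverWins c) = 0 := by linarith
    exact (mul_eq_zero.1 h3).resolve_left hp.ne'
  rwa [measureReal_eq_zero_iff] at h2

lemma mem_winsBlock_firstWinsBlock {c : ℕ} {ω : Races} (h : ω ∉ neverWins c) :
    ω ∈ winsBlock c (firstWinsBlock c ω) := by
  simp only [neverWins, Set.mem_ofPred_eq, not_forall, not_not] at h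
  exact Nat.sInf_mem h

/-- The exceptional alternative comes from the convention `sInf ∅ = 0`; it has probability zero. -/
lemma firstWinsBlock_eq_iff (c k : ℕ) (ω : Races) :
    firstWinsBlock c ω = k ↔ ω ∈ firstAt c k ∨ (k = 0 ∧ ω ∈ neverWins c) := by
  by_cases h : ω ∈ neverWins c
  · have e : {j | ω ∈ winsBlock c j} = ∅ := Set.eq_empty_of_forall_notMem h
    have h1 : ω ∉ firstAt c k := fun hk => h k hk.1
    simp only [firstWinsBlock, e, Nat.sInf_empty, h1, h, and_true, false_or]
    exact eq_comm
  · have hm := mem_winsBlock_firstWinsBlock h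
    have hlt : ∀ j < firstWinsBlock c ω, ω ∉ winsBlock c j := fun j hj => Nat.notMem_of_lt_sInf hj
    simp only [h, and_false, or_false]
    constructor
    · rintro rfl
      exact ⟨hm, hlt⟩
    · rintro ⟨h1, h2⟩
      refine le_antisymm (Nat.sInf_le h1) (not_lt.1 fun hc => h2 _ hc hm)

lemma measurable_firstWinsBlock (c : ℕ) : Measurable (firstWinsBlock c) := by
  refine measurable_to_countable' fun k => ?_
  have : firstWinsBlock c ⁻¹' {k} = firstAt c k ∪ {ω | k = 0 ∧ ω ∈ neverWins c} := by
    ext ω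
    exact firstWinsBlock_eq_iff c k ω
  rw [this]
  exact (measurableSet_firstAt c k).union ((MeasurableSet.const _).inter (measurableSet_neverWins c))

lemma map_firstWinsBlock (c : ℕ) :
    G.racesLaw.map (firstWinsBlock c) = geometricMeasure (G.p₁ ^ c) := by
  refine Measure.ext_of_singleton fun k => ?_
  have hp : G.p₁ ^ c ≠ 0 := pow_ne_zero c G.p₁_pos.ne'
  rw [geometricMeasure_singleton hp, Measure.map_apply (measurable_firstWinsBlock c)
    (measurableSet_singleton k), Set.Icc.coe_pow, ← racesLaw_firstAt, ofReal_measureReal]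
  refine measure_congr ?_
  have : ∀ᵐ ω ∂G.racesLaw, ω ∉ neverWins c := measure_eq_zero_iff_ae_notMem.1 (racesLaw_neverWins c)
  filter_upwards [this] with ω hω
  refine propext ((firstWinsBlock_eq_iff c k ω).trans ?_)
  simp only [hω, and_false, or_false]
  rfl

lemma path_add (x : G.State) (ω : Races) (n j : ℕ) (h : ∀ i < j, (ω (n + i)).1 = 0) :
    G.path x ω (n + j) = G.run (G.path x ω n) (List.replicate j 0) := by
  induction j with
  | zero => rfl
  | succ j ih =>
    rw [List.replicate_succ', run_append, ← ih fun i hi => h i (hi.trans j.lt_succ_self),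
      ← add_assoc, path_succ, h j j.lt_succ_self]
    rfl

lemma exists_geometric_domination (hg : G.BoundedGap g) :
    ∃ N : G.Omega → ℕ, Measurable N ∧
      (G.law (Measure.dirac G.base)).map N = geometricMeasure (G.p₁ ^ (g + max g G.pol₁.s + 1)) ∧
      ∀ᵐ ω ∂(G.law (Measure.dirac G.base)),
        G.passageTime G.base ω ≤ (((g + max g G.pol₁.s + 1) * (N ω + 1) : ℕ) : ℕ∞) := by
  set c := g + max g G.pol₁.s + 1 with hc
  have hm : Measurable fun ω : G.Omega => firstWinsBlock c ω.2 :=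
    (measurable_firstWinsBlock c).comp measurable_snd
  refine ⟨fun ω => firstWinsBlock c ω.2, hm, ?_, ?_⟩
  · rw [law_dirac, Measure.map_map hm measurable_prodMk_left]
    exact map_firstWinsBlock c
  · have hS : MeasurableSet {ω : G.Omega | ω.1 = G.base ∧ ω.2 ∉ neverWins c} :=
      (measurable_fst (measurableSet_singleton _)).inter
        (measurable_snd (measurableSet_neverWins c).compl)
    have h1 : ∀ᵐ ω ∂(G.law (Measure.dirac G.base)), ω.1 = G.base ∧ ω.2 ∉ neverWins c := by
      rw [ae_iff]
      change G.law (Measure.dirac G.base) {ω : G.Omega | ω.1 = G.base ∧ ω.2 ∉ neverWins c}ᶜ = 0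
      rw [law_dirac_apply _ hS.compl]
      simpa using racesLaw_neverWins (G := G) c
    filter_upwards [h1] with ω hω
    obtain ⟨h1, h2⟩ := hω
    have hw := mem_winsBlock_firstWinsBlock h2
    set N := firstWinsBlock c ω.2
    -- Whatever the state at the beginning of the winning block, its `c` wins of player 1 suffice to
    -- enter `(s₂, 0)`, after `j + 1 ≤ c` of them.
    obtain ⟨j, hj, hb⟩ := hg.exists_run_eq_base (G.path G.base ω.2 (N * c))
    have hX : G.X (N * c + (j + 1)) ω = G.base := by
      have h3 := path_add G.base ω.2 (N * c) (j + 1) fun i hi => hw i (by omega)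
      rw [hb, path, ← h1] at h3
      rwa [← h1]
    refine (iInf₂_le (N * c + (j + 1)) ⟨by omega, hX⟩).trans ?_
    have : N * c + (j + 1) ≤ c * (N + 1) :=
      (Nat.add_le_add_left (Nat.succ_le_succ hj) _).trans_eq (by rw [Nat.mul_comm c, Nat.succ_mul])
    exact_mod_cast this

end MiningGame

end

/-! ### Limits of expectations for random initial states -/

section

namespace MiningGame

variable {G : MiningGame} {g K : ℕ} {μ : Measure G.State} [IsProbabilityMeasure μ]

/-- Convergence of the expectations for deterministic initial states and a domination give the
convergence for random initial states. -/
lemma expectationTendsto_of_dominated {Y : ℕ → G.Omega → ℝ} {a : ℝ} {b : G.State → ℝ}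
    (hm : ∀ n, Measurable (Y n)) (hb : Integrable b μ)
    (hi : ∀ n x, Integrable (fun ω => Y n (x, ω)) G.racesLaw)
    (hbd : ∀ n x, ∫ ω, |Y n (x, ω)| ∂G.racesLaw ≤ b x)
    (hlim : ∀ x, Tendsto (fun n => ∫ ω, Y n (x, ω) ∂G.racesLaw) atTop (𝓝 a)) :
    G.ExpectationTendsto μ Y a := by
  have hint : ∀ n, Integrable (Y n) (μ.prod G.racesLaw) := fun n => by
    refine (integrable_prod_iff (hm n).aestronglyMeasurable).2 ⟨ae_of_all _ (hi n), ?_⟩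
    refine Integrable.mono' hb Measurable.of_discrete.aestronglyMeasurable
      (ae_of_all _ fun x => ?_)
    rw [Real.norm_of_nonneg (integral_nonneg fun ω => norm_nonneg _)]
    exact hbd n x
  refine ⟨hint, ?_⟩
  have e : ∀ n, ∫ ω, Y n ω ∂(G.law μ) = ∫ x, ∫ ω, Y n (x, ω) ∂G.racesLaw ∂μ := fun n =>
    integral_prod _ (hint n)
  simp only [e]
  have := tendsto_integral_of_dominated_convergence (μ := μ)
    (F := fun n x => ∫ ω, Y n (x, ω) ∂G.racesLaw) (f := fun _ => a) b
    (fun n => Measurable.of_discrete.aestronglyMeasurable) hb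
    (fun n => ae_of_all _ fun x => (abs_integral_le_integral_abs).trans (hbd n x))
    (ae_of_all _ hlim)
  simpa using this

lemma FiniteMean.integrable_size (h : G.FiniteMean μ) : Integrable (size (G := G)) μ := by
  have := (integrable_const (1 : ℝ)).add h
  refine this.congr (ae_of_all _ fun x => ?_)
  simp [size, add_assoc]

lemma integral_le_of_rate {F : Races → ℝ} (hF : Integrable F G.racesLaw) {a : ℝ} :
    |∫ ω, F ω ∂G.racesLaw - a| ≤ ∫ ω, |F ω - a| ∂G.racesLaw := by
  have h2 := abs_integral_le_integral_abs (μ := G.racesLaw) (f := fun ω => F ω - a)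
  rw [integral_sub hF (integrable_const _)] at h2
  simpa using h2

/-- Convergence of expectations from a rate of `L¹` convergence. -/
lemma expectationTendsto_of_rate {Y : ℕ → G.Omega → ℝ} {a C : ℝ} (hC : 0 ≤ C)
    (hμ : G.FiniteMean μ) (hm : ∀ n, Measurable (Y n))
    (hi : ∀ n x, Integrable (fun ω => Y n (x, ω)) G.racesLaw)
    (hbd : ∀ (n : ℕ) x, 0 < n →
      ∫ ω, |Y n (x, ω) - a| ∂G.racesLaw ≤ C * size x * (√((n : ℝ) + 1) / n))
    (h0 : ∀ ω, Y 0 ω = 0) :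
    G.ExpectationTendsto μ Y a := by
  -- The factor 2 bounds `√(n + 1) / n` for `n ≥ 1`; the case `n = 0`, a division by zero, is
  -- covered by `h0`.
  refine expectationTendsto_of_dominated (b := fun x => |a| + 2 * C * size x) hm
    ((integrable_const _).add (hμ.integrable_size.const_mul _)) hi (fun n x => ?_) fun x => ?_
  · have hs := size_pos x
    rcases Nat.eq_zero_or_pos n with rfl | hn
    · simp only [h0, abs_zero, integral_zero]
      positivity
    · have hn1 : (1 : ℝ) ≤ n := by exact_mod_cast hn
      have hpt : ∀ ω, |Y n (x, ω)| ≤ |Y n (x, ω) - a| + |a| := fun ω => by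
        simpa using abs_add_le (Y n (x, ω) - a) a
      have i1 := ((hi n x).sub (integrable_const a)).abs
      have h1 := integral_mono (hi n x).abs (i1.add (integrable_const |a|)) hpt
      rw [integral_add' i1 (integrable_const _)] at h1
      simp only [integral_const, probReal_univ, one_smul] at h1
      have h2 : √((n : ℝ) + 1) / n ≤ 2 := by
        rw [div_le_iff₀ (by linarith), Real.sqrt_le_left (by linarith)]
        nlinarith
      have h3 := hbd n x hn
      have h4 : C * size x * (√((n : ℝ) + 1) / n) ≤ C * size x * 2 := by gcongr
      refine h1.trans ?_
      change ∫ ω, |Y n (x, ω) - a| ∂G.racesLaw + |a| ≤ _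
      linarith
  · rw [tendsto_iff_norm_sub_tendsto_zero]
    have hz := tendsto_sqrt_div.const_mul (C * size x)
    rw [mul_zero] at hz
    refine squeeze_zero' (Eventually.of_forall fun _ => norm_nonneg _) ?_ hz
    filter_upwards [eventually_gt_atTop 0] with n hn
    exact (integral_le_of_rate (hi n x)).trans (hbd n x hn)

lemma ExpectationTendsto.sub_const_mul {μ : Measure G.State} {Y Z : ℕ → G.Omega → ℝ} {a b : ℝ}
    (hY : G.ExpectationTendsto μ Y a) (hZ : G.ExpectationTendsto μ Z b) (c : ℝ) :
    G.ExpectationTendsto μ (fun n ω => Y n ω - c * Z n ω) (a - c * b) := by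
  refine ⟨fun n => (hY.1 n).sub ((hZ.1 n).const_mul c), ?_⟩
  have := hY.2.sub (hZ.2.const_mul c)
  refine this.congr fun n => ?_
  rw [integral_sub (hY.1 n) ((hZ.1 n).const_mul c), integral_const_mul]

lemma sum_r_eq (i : Fin 2) (n : ℕ) (x : G.State) (ω : Races) :
    ∑ k ∈ Finset.range n, G.r i k (x, ω) = G.pathSum (G.reward i) n x ω := rfl

lemma sum_dist_eq (n : ℕ) (x : G.State) (ω : Races) :
    ∑ k ∈ Finset.range n, G.dist k (x, ω) = G.pathSum G.totalReward n x ω := rfl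

lemma abs_div_sub_le {s a : ℝ} {n : ℕ} (hn : 0 < n) : |s / n - a| = (n : ℝ)⁻¹ * |s - n * a| := by
  have hn' : (0 : ℝ) < n := by exact_mod_cast hn
  rw [show s / n - a = (n : ℝ)⁻¹ * (s - n * a) by field_simp, abs_mul, abs_of_pos (by positivity)]

lemma expectationTendsto_rewards (hg : G.BoundedGap g) (hμ : G.FiniteMean μ) (i : Fin 2) :
    G.ExpectationTendsto μ (fun n ω => (∑ k ∈ Finset.range n, G.r i k ω) / n)
      (G.mean (G.rhat i)) := by
  obtain ⟨K, hK⟩ := hg.exists_hitsBase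
  obtain ⟨C, hC, h⟩ := exists_L1_bound_reward hK i
  refine expectationTendsto_of_rate hC hμ
    (fun n => (Finset.measurable_sum _ fun k _ => measurable_r i k).div_const _)
    (fun n x => integrable_pathSum n x fun s _ => s / n) (fun n x hn => ?_) fun ω => by simp
  simp only [sum_r_eq, abs_div_sub_le hn, integral_const_mul]
  calc _ ≤ (n : ℝ)⁻¹ * (C * size x * √(n + 1)) := by gcongr; exact h n x
    _ = _ := by ring

lemma expectationTendsto_avgDist (hg : G.BoundedGap g) (hμ : G.FiniteMean μ) :
    G.ExpectationTendsto μ G.avgDist G.meanDist := by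
  obtain ⟨K, hK⟩ := hg.exists_hitsBase
  obtain ⟨C, hC, h⟩ := exists_L1_bound_totalReward hK
  set D := G.meanDist
  set J := 1 + G.jump with hJ
  have hJ0 : 0 ≤ J := by linarith [jump_pos (G := G)]
  -- The sum runs over turns `1` to `n`, so it is a path sum of `n + 1` turns without turn `0`,
  -- whose reward is at most a multiple of `size x`.
  have hsum : ∀ (n : ℕ) x ω, G.avgDist n (x, ω) =
      (1 + (G.pathSum G.totalReward (n + 1) x ω - G.totalReward x (ω 0).1)) / n := fun n x ω => by
    have h1 : ∑ k ∈ Finset.Icc 1 n, G.dist k (x, ω) =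
        ∑ k ∈ Finset.range n, G.dist (k + 1) (x, ω) := by
      rw [Finset.sum_bij' (fun k _ => k - 1) (fun k _ => k + 1)] <;> simp +contextual
      omega
    have h2 : G.pathSum G.totalReward (n + 1) x ω =
        ∑ k ∈ Finset.range n, G.dist (k + 1) (x, ω) + G.totalReward x (ω 0).1 :=
      Finset.sum_range_succ' _ n
    rw [avgDist, h1, h2, add_sub_cancel_right]
  have hab : ∀ x w, |G.totalReward x w| ≤ 2 * J * size x := fun x w => by
    have h0 := abs_reward_le 0 x w
    have h1 := abs_reward_le 1 x w
    have := abs_add_le (G.reward 0 x w) (G.reward 1 x w)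
    rw [totalReward]
    linarith
  have hi : ∀ n x, Integrable (fun ω => G.avgDist n (x, ω)) G.racesLaw := fun n x =>
    integrable_of_winners (n + 1) fun ω ω' hω => by
      simp only [hsum]
      rw [pathSum_congr x hω, hω 0 n.succ_pos]
  refine expectationTendsto_of_rate (C := 2 * C + (1 + |D| + 2 * J)) (by positivity) hμ
    (fun n => ((measurable_const.add
      (Finset.measurable_sum _ fun k _ => measurable_dist k)).div_const _)) hi
    (fun n x hn => ?_) fun ω => by simp [avgDist]
  have hs := one_le_size x
  have hn' : (0 : ℝ) < n := by exact_mod_cast hn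
  have hsq : 1 ≤ √((n : ℝ) + 1) := by
    rw [Real.one_le_sqrt]; linarith
  have hpt : ∀ ω, |G.avgDist n (x, ω) - D| ≤ (n : ℝ)⁻¹ *
      (|G.pathSum G.totalReward (n + 1) x ω - (n + 1 : ℕ) * D| + (1 + |D| + 2 * J) * size x) :=
    fun ω => by
      rw [hsum, abs_div_sub_le hn]
      gcongr
      have e : 1 + (G.pathSum G.totalReward (n + 1) x ω - G.totalReward x (ω 0).1) - n * D =
          (G.pathSum G.totalReward (n + 1) x ω - (n + 1 : ℕ) * D) +
            (1 + D - G.totalReward x (ω 0).1) := by push_cast; ring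
      rw [e]
      refine (abs_add_le _ _).trans (add_le_add le_rfl ?_)
      have h1 := abs_sub (1 + D) (G.totalReward x (ω 0).1)
      have h2 := abs_add_le 1 D
      have h3 := hab x (ω 0).1
      rw [abs_one] at h2
      nlinarith [abs_nonneg D]
  have i1 := integrable_pathSum (φ := G.totalReward) (n + 1) x fun s _ => |s - (n + 1 : ℕ) * D|
  have h1 := integral_mono ((hi n x).sub (integrable_const D)).abs
    ((i1.add (integrable_const _)).const_mul (n : ℝ)⁻¹) hpt
  rw [integral_const_mul, integral_add' i1 (integrable_const _)] at h1
  simp only [integral_const, probReal_univ, one_smul] at h1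
  refine h1.trans ?_
  have h2 : √(((n + 1 : ℕ) : ℝ) + 1) ≤ 2 * √((n : ℝ) + 1) := by
    rw [Real.sqrt_le_left (by positivity), mul_pow, Real.sq_sqrt (by positivity)]
    push_cast
    linarith
  calc _ ≤ (n : ℝ)⁻¹ * (C * size x * (2 * √((n : ℝ) + 1)) +
        (1 + |D| + 2 * J) * size x * √((n : ℝ) + 1)) := by
        gcongr ?_ * (?_ + ?_)
        · exact (h (n + 1) x).trans (by gcongr)
        · exact le_mul_of_one_le_right (by positivity) hsq
    _ = _ := by ring

lemma expectationTendsto_durations :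
    G.ExpectationTendsto μ (fun n ω => (∑ k ∈ Finset.range n, G.tau k ω) / n) G.rate⁻¹ := by
  have hi : ∀ k, Integrable (G.tau k) (G.law μ) := fun k => (integrable_duration k).comp_snd μ
  have hk : ∀ k, ∫ ω, G.tau k ω ∂(G.law μ) = G.rate⁻¹ := fun k => by
    have h1 : ∫ ω, G.tau k ω ∂(G.law μ) = ∫ ω : Races, (ω k).2 ∂G.racesLaw := by
      have := integral_fun_snd (μ := μ) (ν := G.racesLaw) fun ω : Races => (ω k).2
      rw [probReal_univ, one_smul] at this
      exact this
    have h2 : ∫ ω : Races, (ω k).2 ∂G.racesLaw = ∫ a, a.2 ∂G.raceLaw := by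
      rw [← (measurePreserving_eval_infinitePi (fun _ : ℕ => G.raceLaw) k).map_eq,
        integral_map (measurable_pi_apply k).aemeasurable measurable_snd.aestronglyMeasurable]
      rfl
    have h3 := integral_fun_snd (μ := G.winnerLaw) (ν := expMeasure G.rate) fun t : ℝ => t
    rw [h1, h2, raceLaw, h3, integral_id_expMeasure G.rate_pos]
    simp
  refine ⟨fun n => (integrable_finsetSum _ fun k _ => hi k).div_const _, ?_⟩
  refine tendsto_const_nhds.congr' ?_
  filter_upwards [eventually_gt_atTop 0] with n hn
  have hn' : (0 : ℝ) < n := by exact_mod_cast hn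
  rw [integral_div, integral_finsetSum _ fun k _ => hi k]
  simp only [hk, Finset.sum_const, Finset.card_range, nsmul_eq_mul]
  field_simp

lemma expectationTendsto_avgRevenue (hg : G.BoundedGap g) (hμ : G.FiniteMean μ) (i : Fin 2) :
    G.ExpectationTendsto μ (G.avgRevenue i) (G.mean (G.rhat i) - G.cost i * G.rate⁻¹) := by
  have := (expectationTendsto_rewards hg hμ i).sub_const_mul expectationTendsto_durations
    (G.cost i)
  have e : G.avgRevenue i = fun n ω => (∑ k ∈ Finset.range n, G.r i k ω) / n -
      G.cost i * ((∑ k ∈ Finset.range n, G.tau k ω) / n) := by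
    funext n ω
    rw [avgRevenue, Finset.sum_sub_distrib, ← Finset.mul_sum, sub_div, mul_div_assoc]
  rwa [e]

lemma Feasible.ratio_mem (hF : G.Feasible) (i : Fin 2) (n : ℕ) (ω : G.Omega) :
    0 ≤ G.ratio i n ω ∧ G.ratio i n ω ≤ 1 := by
  have h0 : ∀ j k, 0 ≤ G.r j k ω := fun j k => hF.reward_nonneg j _ _
  have hle : ∑ k ∈ Finset.range n, G.r i k ω ≤ ∑ k ∈ Finset.range n, G.dist k ω :=
    Finset.sum_le_sum fun k _ => by
      have a0 := h0 0 k
      have a1 := h0 1 k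
      unfold dist
      fin_cases i <;> simp <;> assumption
  have hnn : 0 ≤ ∑ k ∈ Finset.range n, G.r i k ω := Finset.sum_nonneg fun k _ => h0 i k
  unfold ratio
  exact ⟨div_nonneg hnn (by linarith), div_le_one_of_le₀ (by linarith) (by linarith)⟩

/-- The `L¹` laws for numerator and denominator give convergence from each fixed state; as the ratio
lies in `[0, 1]`, dominated convergence extends it to every initial distribution. -/
lemma Feasible.expectationTendsto_ratio (hF : G.Feasible) (hg : G.BoundedGap g) (i : Fin 2) :
    G.ExpectationTendsto μ (G.ratio i) (G.mean (G.rhat i) / G.meanDist) := by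
  obtain ⟨K, hK⟩ := hg.exists_hitsBase
  obtain ⟨A, hA, hL⟩ := exists_L1_bound_reward hK i
  obtain ⟨B, hB, hL'⟩ := exists_L1_bound_totalReward hK
  have hD : 0 < G.meanDist := hF.mean_rhat_pos hg
  set D := G.meanDist
  set a := G.mean (G.rhat i)
  have hi : ∀ n x, Integrable (fun ω => G.ratio i n (x, ω)) G.racesLaw := fun n x =>
    integrable_of_winners n fun ω ω' hω => by
      simp only [ratio, sum_r_eq, sum_dist_eq]
      rw [pathSum_congr x hω, pathSum_congr x hω]
  refine expectationTendsto_of_dominated (b := fun _ => 1)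
    (fun n => (Finset.measurable_sum _ fun k _ => measurable_r i k).div
      (measurable_const.add (Finset.measurable_sum _ fun k _ => measurable_dist k)))
    (integrable_const _) hi (fun n x => ?_) fun x => ?_
  · have := integral_mono (hi n x).abs (integrable_const (1 : ℝ)) fun ω => by
      rw [abs_of_nonneg (hF.ratio_mem i n _).1]
      exact (hF.ratio_mem i n _).2
    simpa using this
  · rw [tendsto_iff_norm_sub_tendsto_zero]
    have hz : Tendsto (fun n : ℕ => D⁻¹ * ((A + B) * size x * (√((n : ℝ) + 1) / n) + 1 / n))
        atTop (𝓝 0) := by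
      simpa using ((tendsto_sqrt_div.const_mul ((A + B) * size x)).add
        (tendsto_one_div_atTop_nhds_zero_nat (𝕜 := ℝ))).const_mul D⁻¹
    refine squeeze_zero' (Eventually.of_forall fun _ => norm_nonneg _) ?_ hz
    filter_upwards [eventually_gt_atTop 0] with n hn
    have hn' : (0 : ℝ) < n := by exact_mod_cast hn
    refine (integral_le_of_rate (hi n x)).trans ?_
    have hpt : ∀ ω, |G.ratio i n (x, ω) - a / D| ≤ (D * n)⁻¹ *
        ((|G.pathSum (G.reward i) n x ω - n * a| +
          |G.pathSum G.totalReward n x ω - n * D|) + 1) := fun ω => by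
      have hr := hF.ratio_mem i n (x, ω)
      have hs := hF.pathSum_nonneg n x ω
      set q := G.ratio i n (x, ω) with hq
      set s := G.pathSum (G.reward i) n x ω
      set t := G.pathSum G.totalReward n x ω
      have hqs : q * (1 + t) = s := by
        rw [hq, ratio, sum_r_eq, sum_dist_eq]
        exact div_mul_cancel₀ _ (by positivity)
      -- Writing the numerator as `q * (1 + t)` avoids dividing by the random denominator: the
      -- coefficient of `t - n * D` is `q`, which is at most one.
      have e : q - a / D = (D * n)⁻¹ * ((s - n * a) - q * (t - n * D) - q) := by
        rw [← hqs]; field_simp; ring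
      rw [e, abs_mul, abs_of_pos (by positivity)]
      gcongr
      have h1 := abs_sub (s - n * a - q * (t - n * D)) q
      have h2 := abs_sub (s - n * a) (q * (t - n * D))
      rw [abs_mul, abs_of_nonneg hr.1] at h2
      rw [abs_of_nonneg hr.1] at h1
      have h3 := mul_le_mul_of_nonneg_right hr.2 (abs_nonneg (t - n * D))
      linarith
    have i1 := integrable_pathSum (φ := G.reward i) n x fun s _ => |s - n * a|
    have i2 := integrable_pathSum (φ := G.totalReward) n x fun s _ => |s - n * D|
    have h1 := integral_mono ((hi n x).sub (integrable_const (a / D))).abs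
      (((i1.add i2).add (integrable_const (1 : ℝ))).const_mul (D * n)⁻¹) hpt
    rw [integral_const_mul, integral_add' (i1.add i2) (integrable_const _),
      integral_add' i1 i2] at h1
    simp only [integral_const, probReal_univ, one_smul] at h1
    refine h1.trans ?_
    calc _ ≤ (D * n)⁻¹ * ((A * size x * √(n + 1) + B * size x * √(n + 1)) + 1) := by
          gcongr
          · exact hL n x
          · exact hL' n x
      _ = _ := by field_simp

/-- The only possible limit of the expected time per validated block. -/
lemma Feasible.eq_of_timePerBlock (hF : G.Feasible) (hg : G.BoundedGap g) {t : ℝ}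
    (h : G.ExpectationTendsto μ G.timePerBlock t) : t = G.rate⁻¹ * G.meanDist⁻¹ := by
  obtain ⟨⟨b, hb⟩, hlim⟩ := hF.inv_dist hg
  refine tendsto_nhds_unique h.2 ?_
  have hrate : 0 < G.rate⁻¹ := inv_pos.2 G.rate_pos
  have e : ∀ (n : ℕ) (x : G.State), ∫ ω, G.timePerBlock n (x, ω) ∂G.racesLaw =
      G.rate⁻¹ * ∫ ω, n / (1 + G.pathSum G.totalReward n x ω) ∂G.racesLaw := fun n x => by
    -- The absolute value makes `ζ` bounded by one on all of `ℝ`; it is harmless since path sums of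
    -- rewards are nonnegative.
    have h1 := integral_durations_mul (G := G) (φ := G.totalReward) (ζ := fun s => (1 + |s|)⁻¹)
      (fun s => by
        rw [abs_of_pos (by positivity)]
        exact inv_le_one_of_one_le₀ (by linarith [abs_nonneg s])) n x 0
    simp only [zero_add, abs_of_nonneg (hF.pathSum_nonneg n x _)] at h1
    simp only [div_eq_mul_inv]
    rw [integral_const_mul, ← mul_assoc, mul_comm G.rate⁻¹, ← h1]
    rfl
  have e2 : ∀ n, ∫ ω, G.timePerBlock n ω ∂(G.law μ) =
      ∫ x, G.rate⁻¹ * ∫ ω, n / (1 + G.pathSum G.totalReward n x ω) ∂G.racesLaw ∂μ := fun n => by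
    simp only [← e]
    exact integral_prod _ (h.1 n)
  simp only [e2]
  have := tendsto_integral_of_dominated_convergence (μ := μ)
    (F := fun (n : ℕ) x =>
      G.rate⁻¹ * ∫ ω, n / (1 + G.pathSum G.totalReward n x ω) ∂G.racesLaw)
    (f := fun _ => G.rate⁻¹ * G.meanDist⁻¹) (fun _ => G.rate⁻¹ * b)
    (fun n => Measurable.of_discrete.aestronglyMeasurable) (integrable_const _)
    (fun n => ae_of_all _ fun x => by
      rw [norm_mul, Real.norm_of_nonneg hrate.le, Real.norm_of_nonneg (integral_nonneg fun ω =>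
        div_nonneg n.cast_nonneg (by linarith [hF.pathSum_nonneg n x ω]))]
      exact mul_le_mul_of_nonneg_left (hb n x) hrate.le)
    (ae_of_all _ fun x => (hlim x).const_mul _)
  simpa using this

end MiningGame

end

end

theorem mainTheorem7 (G : MiningGame) (g : ℕ) (hg : G.BoundedGap g) :
    -- positive recurrence
    G.IsPositiveRecurrent ∧
    -- domination of the return time to `(s₂, 0)`; the factor is `2 g + 1` when `s₁ ≤ g`
    (∃ N : G.Omega → ℕ, Measurable N ∧
      (G.law (Measure.dirac G.base)).map N =
        geometricMeasure (G.p₁ ^ (g + max g G.pol₁.s + 1)) ∧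
      ∀ᵐ ω ∂(G.law (Measure.dirac G.base)),
        G.passageTime G.base ω ≤ (((g + max g G.pol₁.s + 1) * (N ω + 1) : ℕ) : ℕ∞)) ∧
    -- irreducibility, and the unique stationary distribution `π`
    G.IsIrreducible ∧
    ∃ π : G.State → ℝ, G.IsStationary π ∧ (∀ π', G.IsStationary π' → π' = π) ∧
      -- long-run payoffs
      (G.Feasible →
        (∀ i, Summable fun m => π m * G.rhat i m) ∧
        ∃ D : ℝ, 0 < D ∧ D = G.pairing π (fun m => G.rhat 0 m + G.rhat 1 m) ∧
          (∀ μ : Measure G.State, IsProbabilityMeasure μ → G.FiniteMean μ →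
            G.ExpectationTendsto μ G.avgDist D) ∧
          ∃ Gain : Fin 2 → ℝ, (∀ i, Gain i = G.pairing π (G.rhat i) / D) ∧
            (∀ μ : Measure G.State, IsProbabilityMeasure μ →
              ∀ i, G.ExpectationTendsto μ (G.ratio i) (Gain i)) ∧
            ∀ (τbar : ℝ) (ν : Measure G.State), IsProbabilityMeasure ν →
              G.ExpectationTendsto ν G.timePerBlock τbar →
              ∀ μ : Measure G.State, IsProbabilityMeasure μ → G.FiniteMean μ →
                ∀ i, ∃ R : ℝ, G.ExpectationTendsto μ (G.avgRevenue i) R ∧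
                  R = D * (Gain i - G.cost i * τbar) ∧
                  R = G.pairing π (G.rhat i) - G.cost i * τbar * D) := by
  obtain ⟨K, hK⟩ := hg.exists_hitsBase
  have hr : ∀ i, HasSum (fun m => G.stat m * G.rhat i m) (G.mean (G.rhat i)) := fun i =>
    MiningGame.hasSum_stat hK (MiningGame.hasGrowth_rhat i)
  refine ⟨MiningGame.isPositiveRecurrent hg, MiningGame.exists_geometric_domination hg,
    MiningGame.isIrreducible hg, G.stat, MiningGame.isStationary_stat hK,
    fun π' hπ' => hπ'.eq_stat hK, fun hF => ⟨fun i => (hr i).summable, ?_⟩⟩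
  have hD : 0 < G.meanDist := hF.mean_rhat_pos hg
  have hp : ∀ i, G.pairing G.stat (G.rhat i) = G.mean (G.rhat i) := fun i => (hr i).tsum_eq
  refine ⟨G.meanDist, hD, ?_, fun μ _ hμ => MiningGame.expectationTendsto_avgDist hg hμ,
    fun i => G.mean (G.rhat i) / G.meanDist, fun i => by rw [hp],
    fun μ _ i => hF.expectationTendsto_ratio hg i, fun τbar ν _ hν μ _ hμ i =>
      ⟨_, MiningGame.expectationTendsto_avgRevenue hg hμ i, ?_, ?_⟩⟩
  · have := ((hr 0).add (hr 1)).tsum_eq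
    simp only [← mul_add] at this
    exact this.symm
  -- The limit under `ν` forces `τbar = (rate * D)⁻¹`, so the cost term `cost i * τbar * D` equals
  -- the cost per turn `cost i / rate`.
  · rw [hF.eq_of_timePerBlock hg hν]
    field_simp
  · rw [hF.eq_of_timePerBlock hg hν, hp]
    field_simp
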